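/- Let $\Omega$ be a domain in $\mathbb{R}^d$, or a noncompact connected $d$-dimensional Riemannian manifold (only its smooth structure is used), and let $\mu$ be a Borel measure on $\Omega$ which in every coordinate chart has a positive, measurable, locally bounded density with respect to Lebesgue measure (on a Riemannian manifold: $d\mu=m\,dx$ with $dx$ the volume form and $m>0$ measurable and locally bounded). Let $A$ be given in any coordinate chart $U$ by a measurable symmetric matrix-valued function such that for every $K\Subset U$ there is $\lambda_K\ge 1$ with $\lambda_K^{-1}I\le A(x)\le\lambda_K I$ for $x\in K$, and write $\langle A\nabla u,\nabla v\rangle=\sum_{i,j}A_{ij}\,\partial_i u\,\overline{\partial_j v}$. Let $W\in L^\infty(\Omega,\mu)$ be real-valued. For complex-valued functions put $$q(u,v)=\int_\Omega\langle A\nabla u,\nabla v\rangle\,d\mu+\int_\Omega W u\overline{v}\,d\mu,\qquad \|v\|_q^2=q(v,v)+(1+\|W\|_\infty)\|v\|_{L^2(\mu)}^2,$$ first for $v\in C_0^\infty(\Omega)$, the smooth compactly supported functions. Let $\mathcal D(q)$ be the closure of $C_0^\infty(\Omega)$: the set of $v\in L^2(\Omega,\mu)$ for which there are $v_n\in C_0^\infty(\Omega)$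 that form a $\|\cdot\|_q$-Cauchy sequence and converge to $v$ in $L^2(\Omega,\mu)$; and $\|v\|_q=\lim_n\|v_n\|_q$ for such a sequence (the infimum of these limits over all such sequences, should they depend on the sequence, which does not happen when the form is closable). Let $\lambda\in\mathbb{R}$, and let $u\in W^{1,2}_{\mathrm{loc}}(\Omega)$ be a generalized eigenfunction of $L+W=-\mathrm{div}(A\nabla)+W$ with eigenvalue $\lambda$, that is, $u\neq 0$ and $$q(u,v)=\lambda\int_\Omega u\overline{v}\,d\mu\qquad\text{for all } v\in C_0^\infty(\Omega).$$ Suppose that $|u|\le 1$ almost everywhere in $\Omega$. Then for every $v\in\mathcal D(q)$ with $\|v\|_q\le 1$ the function $|v|^2\langle A\nabla u,\nabla u\rangle$ is $\mu$-integrable and $$\int_\Omega |v|^2\langle A\nabla u,\nabla u\rangle\,d\mu\ \le\ \Big(1+\sqrt{1+|\lambda|+\|W\|_\infty}\Big)^2 .$$ -/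

import Mathlib

open MeasureTheory Filter Topology Set
open scoped Manifold ContDiff

/-!
Conventions.  `Ω` is a smooth `d`-dimensional manifold without boundary, modelled on Euclidean
space; functions on `Ω` are complex valued, and the potential is real valued.  The differential of
a function is a field of covectors with complex values.  The coefficient field `A` is a field of
symmetric bilinear forms on the cotangent spaces, so that in local coordinates
`⟨A∇u, ∇v⟩ = ∑ i j, A i j * ∂ᵢ u * conj (∂ⱼ v)`.
-/

namespace Shnol

noncomputable section

/-- The real part of a complex-valued covector. -/
def covRe {V : Type*} [AddCommGroup V] [Module ℝ V] [TopologicalSpace V]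
    (ξ : V →L[ℝ] ℂ) : V →L[ℝ] ℝ :=
  Complex.reCLM.comp ξ

/-- The imaginary part of a complex-valued covector. -/
def covIm {V : Type*} [AddCommGroup V] [Module ℝ V] [TopologicalSpace V]
    (ξ : V →L[ℝ] ℂ) : V →L[ℝ] ℝ :=
  Complex.imCLM.comp ξ

/-- The sesquilinear extension of a real bilinear form `a` on covectors to complex covectors,
linear in the first and conjugate linear in the second variable.  With `a = A x`, `ξ = du x` and
`η = dv x` this is `⟨A∇u, ∇v⟩` at `x`. -/
def sesq {V : Type*} [AddCommGroup V] [Module ℝ V] [TopologicalSpace V]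
    (a : LinearMap.BilinForm ℝ (V →L[ℝ] ℝ)) (ξ η : V →L[ℝ] ℂ) : ℂ :=
  ((a (covRe ξ) (covRe η) + a (covIm ξ) (covIm η) : ℝ) : ℂ)
    + ((a (covIm ξ) (covRe η) - a (covRe ξ) (covIm η) : ℝ) : ℂ) * Complex.I

section Manifold

variable {d : ℕ} {Ω : Type*} [TopologicalSpace Ω] [ChartedSpace (EuclideanSpace ℝ (Fin d)) Ω]

/-- A field of complex-valued covectors on `Ω`. -/
abbrev CovectorField (d : ℕ) (Ω : Type*) [TopologicalSpace Ω]
    [ChartedSpace (EuclideanSpace ℝ (Fin d)) Ω] : Type _ :=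
  ∀ x : Ω, TangentSpace (𝓡 d) x →L[ℝ] ℂ

/-- A field of bilinear forms on the cotangent spaces of `Ω`. -/
abbrev CoefficientField (d : ℕ) (Ω : Type*) [TopologicalSpace Ω]
    [ChartedSpace (EuclideanSpace ℝ (Fin d)) Ω] : Type _ :=
  ∀ x : Ω, LinearMap.BilinForm ℝ (TangentSpace (𝓡 d) x →L[ℝ] ℝ)

/-- The field of bilinear forms `A` in the chart `e`, at the point `y` of the coordinate space:
`A` evaluated at the pull-backs under `e` of two covectors of the coordinate space.  For the
coordinate covectors `η = dyᵢ` and `ζ = dyⱼ` it is the entry `i j` of the coefficient matrix. -/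
def CoefficientField.inChart (A : CoefficientField d Ω)
    (e : OpenPartialHomeomorph Ω (EuclideanSpace ℝ (Fin d))) (y : EuclideanSpace ℝ (Fin d))
    (η ζ : EuclideanSpace ℝ (Fin d) →L[ℝ] ℝ) : ℝ :=
  A (e.symm y)
    (η.comp (mfderiv (𝓡 d) (𝓡 d) e (e.symm y)))
    (ζ.comp (mfderiv (𝓡 d) (𝓡 d) e (e.symm y)))

/-- The covector field `D` in the chart `e`: its pull-back under `e.symm`. -/
def CovectorField.inChart (D : CovectorField d Ω)
    (e : OpenPartialHomeomorph Ω (EuclideanSpace ℝ (Fin d))) (y : EuclideanSpace ℝ (Fin d)) :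
    EuclideanSpace ℝ (Fin d) →L[ℝ] ℂ :=
  (D (e.symm y)).comp (mfderiv (𝓡 d) (𝓡 d) e.symm y)

/-- `A` is a measurable field of symmetric matrices which is locally uniformly elliptic: on every
compact part `K` of a coordinate chart, `c⁻¹ I ≤ A ≤ c I` for some constant `c ≥ 1` depending
on `K`. -/
structure IsLocallyElliptic (A : CoefficientField d Ω) : Prop where
  symm : ∀ x ξ η, A x ξ η = A x η ξ
  measurable : ∀ e ∈ atlas (EuclideanSpace ℝ (Fin d)) Ω, ∀ η ζ,
    AEMeasurable (fun y => A.inChart e y η ζ) (volume.restrict e.target)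
  elliptic : ∀ e ∈ atlas (EuclideanSpace ℝ (Fin d)) Ω, ∀ K ⊆ e.target, IsCompact K →
    ∃ c : ℝ, 1 ≤ c ∧ ∀ y ∈ K, ∀ η : EuclideanSpace ℝ (Fin d) →L[ℝ] ℝ,
      c⁻¹ * ‖η‖ ^ 2 ≤ A.inChart e y η η ∧ A.inChart e y η η ≤ c * ‖η‖ ^ 2

/-- In every coordinate chart, the measure `μ` has a positive, measurable, locally bounded density
with respect to Lebesgue measure.  On a Riemannian manifold these are the measures
`dμ = m d(vol)` with a positive, measurable, locally bounded function `m`. -/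
def HasPositiveDensity (d : ℕ) {Ω : Type*} [TopologicalSpace Ω]
    [ChartedSpace (EuclideanSpace ℝ (Fin d)) Ω] [MeasurableSpace Ω] (μ : Measure Ω) : Prop :=
  ∀ e ∈ atlas (EuclideanSpace ℝ (Fin d)) Ω, ∃ m : EuclideanSpace ℝ (Fin d) → ℝ,
    Measurable m ∧ (∀ y ∈ e.target, 0 < m y) ∧
    (∀ K ⊆ e.target, IsCompact K → ∃ C : ℝ, ∀ y ∈ K, m y ≤ C) ∧
    (μ.restrict e.source).map e =
      (volume.restrict e.target).withDensity (fun y => ENNReal.ofReal (m y))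

/-- `u` belongs to `W^{1,2}_loc(Ω)` and `Du` is its weak differential: in every coordinate chart,
`u` and `Du` are locally square integrable, and integration by parts against smooth compactly
supported functions holds. -/
structure HasLocalWeakDifferential (u : Ω → ℂ) (Du : CovectorField d Ω) : Prop where
  memLp : ∀ e ∈ atlas (EuclideanSpace ℝ (Fin d)) Ω, ∀ K ⊆ e.target, IsCompact K →
    MemLp (fun y => u (e.symm y)) 2 (volume.restrict K)
  memLp_differential : ∀ e ∈ atlas (EuclideanSpace ℝ (Fin d)) Ω, ∀ K ⊆ e.target, IsCompact K →
    MemLp (fun y => Du.inChart e y) 2 (volume.restrict K)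
  integral_by_parts : ∀ e ∈ atlas (EuclideanSpace ℝ (Fin d)) Ω,
    ∀ φ : EuclideanSpace ℝ (Fin d) → ℝ, ContDiff ℝ ∞ φ → HasCompactSupport φ →
      tsupport φ ⊆ e.target → ∀ w : EuclideanSpace ℝ (Fin d),
      ∫ y in e.target, ((fderiv ℝ φ y w : ℝ) : ℂ) * u (e.symm y)
        = -∫ y in e.target, ((φ y : ℝ) : ℂ) * Du.inChart e y w

/-- `C_0^∞(Ω)`: the smooth compactly supported complex-valued functions. -/
def testFunctions (d : ℕ) (Ω : Type*) [TopologicalSpace Ω]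
    [ChartedSpace (EuclideanSpace ℝ (Fin d)) Ω] : Set (Ω → ℂ) :=
  {v | ContMDiff (𝓡 d) 𝓘(ℝ, ℂ) ∞ v ∧ HasCompactSupport v}

/-- The classical differential of a smooth function. -/
def differential (d : ℕ) {Ω : Type*} [TopologicalSpace Ω]
    [ChartedSpace (EuclideanSpace ℝ (Fin d)) Ω] (v : Ω → ℂ) : CovectorField d Ω :=
  fun x => (mfderiv (𝓡 d) 𝓘(ℝ, ℂ) v x : TangentSpace (𝓡 d) x →L[ℝ] ℂ)

variable [MeasurableSpace Ω]

/-- `q(u,v) = ∫ ⟨A∇u, ∇v⟩ dμ + ∫ W u conj(v) dμ`, for functions `u`, `v` with (weak)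
differentials `Du`, `Dv`. -/
def form (A : CoefficientField d Ω) (μ : Measure Ω) (W : Ω → ℝ)
    (u : Ω → ℂ) (Du : CovectorField d Ω) (v : Ω → ℂ) (Dv : CovectorField d Ω) : ℂ :=
  (∫ x, sesq (A x) (Du x) (Dv x) ∂μ)
    + ∫ x, ((W x : ℝ) : ℂ) * u x * (starRingEnd ℂ) (v x) ∂μ

/-- `u ∈ W^{1,2}_loc(Ω)`, with weak differential `Du`, is a generalized eigenfunction of
`L + W = -div(A∇) + W` with eigenvalue `lam`. -/
structure IsGeneralizedEigenfunction (A : CoefficientField d Ω) (μ : Measure Ω) (W : Ω → ℝ)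
    (lam : ℝ) (u : Ω → ℂ) (Du : CovectorField d Ω) : Prop where
  weak : HasLocalWeakDifferential u Du
  ne_zero : ¬ (∀ᵐ x ∂μ, u x = 0)
  equation : ∀ v ∈ testFunctions d Ω,
    form A μ W u Du v (differential d v) = (lam : ℂ) * ∫ x, u x * (starRingEnd ℂ) (v x) ∂μ

/-- The norm `‖W‖_∞` of `L^∞(Ω, μ)`. -/
def supNorm (μ : Measure Ω) (W : Ω → ℝ) : ℝ :=
  (eLpNorm W ⊤ μ).toReal

/-- `‖v‖_q` for a test function `v`: `‖v‖_q² = q(v,v) + (1 + ‖W‖_∞) ‖v‖²`. -/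
def testNorm (A : CoefficientField d Ω) (μ : Measure Ω) (W : Ω → ℝ) (v : Ω → ℂ) : ℝ :=
  Real.sqrt ((form A μ W v (differential d v) v (differential d v)).re
    + (1 + supNorm μ W) * ∫ x, ‖v x‖ ^ 2 ∂μ)

/-- The sequence `s` of test functions is Cauchy for `‖·‖_q` and converges to `v` in
`L²(Ω, μ)`. -/
structure IsFormApproximation (A : CoefficientField d Ω) (μ : Measure Ω) (W : Ω → ℝ)
    (v : Ω → ℂ) (s : ℕ → Ω → ℂ) : Prop where
  mem : ∀ n, s n ∈ testFunctions d Ω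
  cauchy : ∀ ε > 0, ∃ N, ∀ m ≥ N, ∀ n ≥ N, testNorm A μ W (s m - s n) < ε
  tendsto : Tendsto (fun n => eLpNorm (v - s n) 2 μ) atTop (𝓝 0)

/-- The domain `𝒟(q)` of the form `q`, the closure of `C_0^∞(Ω)` under the form norm: the
`v ∈ L²(Ω, μ)` that are `L²`-limits of `‖·‖_q`-Cauchy sequences of test functions. -/
def formDomain (A : CoefficientField d Ω) (μ : Measure Ω) (W : Ω → ℝ) : Set (Ω → ℂ) :=
  {v | MemLp v 2 μ ∧ ∃ s, IsFormApproximation A μ W v s}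

/-- The form norm `‖v‖_q` of `v ∈ 𝒟(q)`: the limit of `‖sₙ‖_q` along an approximating sequence
`s` of test functions.  For a closable form this limit does not depend on `s`, and the set below
is a singleton. -/
def formNorm (A : CoefficientField d Ω) (μ : Measure Ω) (W : Ω → ℝ) (v : Ω → ℂ) : ℝ :=
  sInf {N : ℝ | ∃ s, IsFormApproximation A μ W v s ∧
    Tendsto (fun n => testNorm A μ W (s n)) atTop (𝓝 N)}

end Manifold

end

end Shnol

/-! For a test function `v`, the function `|v|² u` is inserted into the equation. Since `∇(|v|² u) =
|v|² ∇u + u ∇|v|²`, the energy `E = ∫ |v|² ⟨A∇u, ∇u⟩` equals `-Re ∫ ⟨A∇u, u ∇|v|²⟩ - ∫ (W - λ) |v|²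
|u|²`. As `|u| ≤ 1`, Young's inequality bounds the first term by `t E + t⁻¹ ∫ ⟨A∇v, ∇v⟩`, and the
second is at most `M ∫ |v|²` with `M = |λ| + ‖W‖_∞`. With `t = 1/s` this gives `(1 - 1/s) E ≤ (M +
s) ‖v‖_q²`. The resulting factor `s (M + s) / (s - 1)` is least at `s = 1 + √(1 + M)`, the root of
`s² = 2 s + M`, and its value there is `s²`. This is `energy_pointwise_le` and `energy_le`.

The function `|v|² u` is not smooth, so its use as a test function needs proof:
`eigenDefect_eq_zero`. A partition of unity reduces to `ρ u` with `ρ` supported in one chart. There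
`ρ u` is mollified; by `fderiv_mollify_mul` the gradient of the mollification is the mollification
of the weak gradient, which converges in `L²`, and the local bounds on `A` and on the density carry
the limit over to the integrals.

For `v` in the form domain, Fatou's lemma is applied along an a.e. convergent subsequence of an
approximating sequence (`IsFormApproximation.lintegral_energy_le`). Closability plays no role: it is
enough that some approximating sequence has norms with limit close to the infimum `formNorm`. -/

namespace Shnol

/-! ### Mollification in Euclidean space and its convergence in `L²`. -/

section Mollification

open scoped Convolution ENNReal

variable {E F : Type*} [NormedAddCommGroup E] [InnerProductSpace ℝ E] [FiniteDimensional ℝ E]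
  [MeasurableSpace E] [BorelSpace E] [NormedAddCommGroup F] [NormedSpace ℝ F]

/-- The convolution of `g` with the normalised bump function `φ`. -/
noncomputable def mollify (φ : ContDiffBump (0 : E)) (g : E → F) : E → F :=
  φ.normed volume ⋆[ContinuousLinearMap.lsmul ℝ ℝ, volume] g

theorem mollify_apply (φ : ContDiffBump (0 : E)) (g : E → F) (x : E) :
    mollify φ g x = ∫ t, φ.normed volume (x - t) • g t := by
  rw [mollify, convolution_eq_swap]; rfl

/-- Jensen's inequality for the square with a weight of mass at most one: Cauchy–Schwarz applied to
`k h = k^(1/2) (k h²)^(1/2)`. -/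
theorem lintegral_mul_sq_le {α : Type*} [MeasurableSpace α] {ν : Measure α} {k h : α → ℝ≥0∞}
    (hk : AEMeasurable k ν) (hh : AEMeasurable h ν) (hk1 : ∫⁻ a, k a ∂ν ≤ 1) :
    (∫⁻ a, k a * h a ∂ν) ^ 2 ≤ ∫⁻ a, k a * h a ^ 2 ∂ν := by
  have key := ENNReal.lintegral_mul_norm_pow_le (μ := ν) (f := k) (g := fun a => k a * h a ^ 2)
    hk (hk.mul (hh.pow_const 2)) (p := 1 / 2) (q := 1 / 2) (by norm_num) (by norm_num)
    (by norm_num)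
  have e1 : ∀ a, k a ^ (1 / 2 : ℝ) * (k a * h a ^ 2) ^ (1 / 2 : ℝ) = k a * h a := by
    intro a
    rw [ENNReal.mul_rpow_of_nonneg _ _ (by norm_num), ← mul_assoc,
      ← ENNReal.rpow_add_of_nonneg _ _ (by norm_num) (by norm_num), ← ENNReal.rpow_natCast,
      ← ENNReal.rpow_mul]
    norm_num
  simp only [e1] at key
  calc (∫⁻ a, k a * h a ∂ν) ^ 2
      ≤ ((∫⁻ a, k a ∂ν) ^ (1 / 2 : ℝ) * (∫⁻ a, k a * h a ^ 2 ∂ν) ^ (1 / 2 : ℝ)) ^ 2 := by gcongr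
    _ ≤ (1 * (∫⁻ a, k a * h a ^ 2 ∂ν) ^ (1 / 2 : ℝ)) ^ 2 := by
        gcongr
        exact ENNReal.rpow_le_one hk1 (by norm_num)
    _ = _ := by
        rw [one_mul, ← ENNReal.rpow_natCast, ← ENNReal.rpow_mul]
        norm_num

theorem eLpNorm_two_sq {α G : Type*} [MeasurableSpace α] [NormedAddCommGroup G] {ν : Measure α}
    (f : α → G) : eLpNorm f 2 ν ^ 2 = ∫⁻ a, ‖f a‖ₑ ^ 2 ∂ν := by
  have := eLpNorm_nnreal_pow_eq_lintegral (μ := ν) (f := f) (p := 2) (by norm_num)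
  rw [← ENNReal.rpow_natCast]
  refine Eq.trans ?_ (this.trans ?_)
  · norm_num
  · norm_num

theorem lintegral_normed_eq_one (φ : ContDiffBump (0 : E)) (x : E) :
    ∫⁻ t, ENNReal.ofReal (φ.normed volume (x - t)) = 1 := by
  rw [lintegral_sub_left_eq_self (fun t => ENNReal.ofReal (φ.normed volume t)) x,
    ← ofReal_integral_eq_lintegral_ofReal φ.integrable_normed
      (ae_of_all _ fun t => φ.nonneg_normed t), φ.integral_normed, ENNReal.ofReal_one]

/-- Mollification is a contraction of `L²`. -/
theorem eLpNorm_mollify_le (φ : ContDiffBump (0 : E)) {g : E → F}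
    (hg : AEStronglyMeasurable g volume) :
    eLpNorm (mollify φ g) 2 volume ≤ eLpNorm g 2 volume := by
  rw [← ENNReal.pow_le_pow_left_iff two_ne_zero, eLpNorm_two_sq, eLpNorm_two_sq]
  have hφ : Continuous (φ.normed (volume : Measure E)) := φ.continuous_normed
  have hφ2 : Measurable fun p : E × E => ENNReal.ofReal (φ.normed volume (p.1 - p.2)) :=
    (ENNReal.continuous_ofReal.comp (hφ.comp (continuous_fst.sub continuous_snd))).measurable
  calc ∫⁻ x, ‖mollify φ g x‖ₑ ^ 2
      ≤ ∫⁻ x, ∫⁻ t, ENNReal.ofReal (φ.normed volume (x - t)) * ‖g t‖ₑ ^ 2 := by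
        refine lintegral_mono fun x => ?_
        refine le_trans ?_ (lintegral_mul_sq_le
          (hφ2.comp measurable_prodMk_left).aemeasurable hg.enorm
            (lintegral_normed_eq_one φ x).le)
        rw [mollify_apply]
        gcongr
        refine (enorm_integral_le_lintegral_enorm _).trans (lintegral_mono fun t => ?_)
        rw [enorm_smul, Real.enorm_of_nonneg (φ.nonneg_normed _)]
    _ = ∫⁻ t, ∫⁻ x, ENNReal.ofReal (φ.normed volume (x - t)) * ‖g t‖ₑ ^ 2 := by
        refine lintegral_lintegral_swap ?_
        have h2 : AEMeasurable (fun p : E × E => ‖g p.2‖ₑ ^ 2) (volume.prod volume) :=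
          (hg.comp_snd (μ := volume)).enorm.pow_const 2
        exact hφ2.aemeasurable.mul h2
    _ = ∫⁻ t, ‖g t‖ₑ ^ 2 := by
        refine lintegral_congr fun t => ?_
        have hm : Measurable fun x => ENNReal.ofReal (φ.normed volume (x - t)) :=
          (ENNReal.continuous_ofReal.comp
            (hφ.comp (continuous_id.sub continuous_const))).measurable
        rw [lintegral_mul_const _ hm]
        -- The kernel is even, so it has mass one in `x` as well as in `t`.
        have : ∫⁻ x, ENNReal.ofReal (φ.normed volume (x - t)) = 1 := by
          rw [← lintegral_normed_eq_one φ t]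
          refine lintegral_congr fun x => ?_
          rw [← neg_sub, φ.normed_neg]
        rw [this, one_mul]

theorem mollify_sub (φ : ContDiffBump (0 : E)) {g h : E → F} (hg : LocallyIntegrable g volume)
    (hh : LocallyIntegrable h volume) : mollify φ (g - h) = mollify φ g - mollify φ h := by
  have key : ∀ f : E → F, LocallyIntegrable f volume → ∀ x,
      Integrable (fun t => φ.normed volume (x - t) • f t) volume := fun f hf x => by
    have := (φ.hasCompactSupport_normed (μ := volume)).convolutionExists_left
      (ContinuousLinearMap.lsmul ℝ ℝ) φ.continuous_normed hf x
    exact (convolutionExistsAt_iff_integrable_swap).1 this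
  ext x
  simp only [Pi.sub_apply, mollify_apply, smul_sub]
  exact integral_sub (key g hg x) (key h hh x)

theorem mollify_eq_zero {φ : ContDiffBump (0 : E)} {g : E → F} {x : E}
    (hx : x ∉ Metric.cthickening φ.rOut (tsupport g)) : mollify φ g x = 0 := by
  rw [mollify_apply]
  refine integral_eq_zero_of_ae (ae_of_all _ fun t => ?_)
  by_cases ht : t ∈ tsupport g
  · have : x - t ∉ Function.support (φ.normed volume) := by
      rw [φ.support_normed_eq, mem_ball_zero_iff, ← dist_eq_norm]
      exact fun h => hx (Metric.mem_cthickening_of_dist_le x t _ _ ht h.le)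
    simp [Function.notMem_support.1 this]
  · simp [image_eq_zero_of_notMem_tsupport ht]

/-- Uniform continuity makes the error at most `η` everywhere, and the error stays supported in the
fixed compact set `K`, so its `L²` norm is at most `vol(K)^(1/2) η`. -/
theorem tendsto_eLpNorm_mollify_sub_of_continuous [CompleteSpace F] {φ : ℕ → ContDiffBump (0 : E)}
    (hφ : Tendsto (fun n => (φ n).rOut) atTop (𝓝 0)) {g : E → F} (hg : Continuous g)
    (hgc : HasCompactSupport g) :
    Tendsto (fun n => eLpNorm (mollify (φ n) g - g) 2 volume) atTop (𝓝 0) := by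
  set K := Metric.cthickening 1 (tsupport g)
  have hK : IsCompact K := IsCompact.cthickening hgc
  have huc : UniformContinuous g := hgc.uniformContinuous_of_continuous hg
  have hV : (volume K) ^ (1 / 2 : ℝ) ≠ ⊤ :=
    ENNReal.rpow_ne_top_of_nonneg (by norm_num) hK.measure_lt_top.ne
  rw [ENNReal.tendsto_nhds_zero]
  intro ε hε
  obtain ⟨η, hη, hηε⟩ : ∃ η : ℝ, 0 < η ∧ (volume K) ^ (1 / 2 : ℝ) * ENNReal.ofReal η ≤ ε := by
    have : Tendsto (fun η : ℝ => (volume K) ^ (1 / 2 : ℝ) * ENNReal.ofReal η) (𝓝[>] 0) (𝓝 0) := by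
      have h1 : Tendsto (fun η : ℝ => ENNReal.ofReal η) (𝓝[>] 0) (𝓝 0) := by
        have := (ENNReal.continuous_ofReal.tendsto 0).mono_left (nhdsWithin_le_nhds (s := Ioi 0))
        simpa using this
      simpa using ENNReal.Tendsto.const_mul h1 (Or.inr hV)
    obtain ⟨η, h1, h2⟩ := ((this.eventually (eventually_le_nhds hε)).and
      self_mem_nhdsWithin).exists
    exact ⟨η, h2, h1⟩
  obtain ⟨δ, hδ, hδη⟩ := Metric.uniformContinuous_iff.1 huc η hη
  filter_upwards [hφ.eventually (gt_mem_nhds hδ), hφ.eventually (gt_mem_nhds one_pos)]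
    with n hn hn1
  have hsupp : Function.support (mollify (φ n) g - g) ⊆ K := by
    intro x hx
    by_contra hxK
    apply hx
    have h1 : mollify (φ n) g x = 0 :=
      mollify_eq_zero fun h => hxK (Metric.cthickening_mono hn1.le _ h)
    have h2 : g x = 0 := image_eq_zero_of_notMem_tsupport
      fun h => hxK (Metric.self_subset_cthickening _ h)
    simp [h1, h2]
  rw [← eLpNorm_restrict_eq_of_support_subset hsupp]
  refine (eLpNorm_le_of_ae_bound (C := η) (ae_of_all _ fun x => ?_)).trans ?_
  · rw [Pi.sub_apply, ← dist_eq_norm]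
    refine (φ n).dist_normed_convolution_le hg.aestronglyMeasurable fun y hy => ?_
    exact (hδη ((Metric.mem_ball.1 hy).trans hn)).le
  · simpa using hηε

/-- Mollifications converge in `L²`. -/
theorem tendsto_eLpNorm_mollify_sub [CompleteSpace F] {φ : ℕ → ContDiffBump (0 : E)}
    (hφ : Tendsto (fun n => (φ n).rOut) atTop (𝓝 0)) {g : E → F} (hg : MemLp g 2 volume) :
    Tendsto (fun n => eLpNorm (mollify (φ n) g - g) 2 volume) atTop (𝓝 0) := by
  rw [ENNReal.tendsto_nhds_zero]
  intro ε hε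
  have hε3 : ε / 3 ≠ 0 := (ENNReal.div_pos hε.ne' (by norm_num)).ne'
  obtain ⟨h, hhc, hgh, hh, hhL⟩ := hg.exists_hasCompactSupport_eLpNorm_sub_le (by norm_num) hε3
  filter_upwards [(ENNReal.tendsto_nhds_zero.1
    (tendsto_eLpNorm_mollify_sub_of_continuous hφ hh hhc)) (ε / 3) (pos_iff_ne_zero.2 hε3)]
    with n hn
  have hmeas : ∀ f : E → F, LocallyIntegrable f volume →
      AEStronglyMeasurable (mollify (φ n) f) volume := fun f hf =>
    ((φ n).hasCompactSupport_normed.continuous_convolution_left _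
      (φ n).continuous_normed hf).aestronglyMeasurable
  have hgi := hg.locallyIntegrable (by norm_num)
  have hhi := hhL.locallyIntegrable (by norm_num)
  -- Three terms of size `ε / 3`: the first because mollification contracts `L²`, the second by the
  -- continuous case, the third by density.
  have e : mollify (φ n) g - g = mollify (φ n) (g - h) + (mollify (φ n) h - h) + (h - g) := by
    rw [mollify_sub _ hgi hhi]; abel
  rw [e]
  refine (eLpNorm_add_le ((hmeas _ (hgi.sub hhi)).add ((hmeas _ hhi).sub
    hhL.aestronglyMeasurable)) (hhL.sub hg).aestronglyMeasurable (by norm_num)).trans ?_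
  calc _ ≤ eLpNorm (mollify (φ n) (g - h)) 2 volume + eLpNorm (mollify (φ n) h - h) 2 volume
        + eLpNorm (h - g) 2 volume := by
        gcongr
        exact eLpNorm_add_le (hmeas _ (hgi.sub hhi)) ((hmeas _ hhi).sub
          hhL.aestronglyMeasurable) (by norm_num)
    _ ≤ ε / 3 + ε / 3 + ε / 3 := by
        gcongr
        · exact (eLpNorm_mollify_le _ (hg.sub hhL).aestronglyMeasurable).trans hgh
        · rwa [eLpNorm_sub_comm]
    _ = ε := ENNReal.add_thirds ε

theorem contDiff_mollify (φ : ContDiffBump (0 : E)) [CompleteSpace F] {g : E → F}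
    (hg : LocallyIntegrable g volume) : ContDiff ℝ ∞ (mollify φ g) :=
  φ.hasCompactSupport_normed.contDiff_convolution_left _ φ.contDiff_normed hg

/-- The derivative falls on the smooth kernel, which can then serve as part of a test function in
the definition of a weak derivative. -/
theorem fderiv_mollify_apply (φ : ContDiffBump (0 : E)) [CompleteSpace F] {g : E → F}
    (hg : LocallyIntegrable g volume) (x z : E) :
    fderiv ℝ (mollify φ g) x z = ∫ t, (fderiv ℝ (φ.normed volume) (x - t) z) • g t := by
  have hd := (φ.hasCompactSupport_normed (μ := volume)).hasFDerivAt_convolution_left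
    (ContinuousLinearMap.lsmul ℝ ℝ) (φ.contDiff_normed (n := 1)) hg x
  have hc := (φ.hasCompactSupport_normed (μ := volume)).fderiv ℝ
  have hcont := (φ.contDiff_normed (n := 1) (μ := volume)).continuous_fderiv one_ne_zero
  rw [mollify, hd.fderiv, convolution_eq_swap, ContinuousLinearMap.integral_apply]
  · rfl
  · exact convolutionExistsAt_iff_integrable_swap.1
      (hc.convolutionExists_left _ hcont hg x)

end Mollification

/-! ### Algebra of the sesquilinear extension, and Young's inequality. -/

section Sesquilinear

variable {V : Type*} [AddCommGroup V] [Module ℝ V] [TopologicalSpace V]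

/-- A real covector, viewed as a complex one. -/
noncomputable def ofRealCov (p : V →L[ℝ] ℝ) : V →L[ℝ] ℂ := Complex.ofRealCLM.comp p

theorem covRe_add (ξ η : V →L[ℝ] ℂ) : covRe (ξ + η) = covRe ξ + covRe η := by
  ext; simp [covRe]

theorem covIm_add (ξ η : V →L[ℝ] ℂ) : covIm (ξ + η) = covIm ξ + covIm η := by
  ext; simp [covIm]

theorem covRe_smul (c : ℂ) (ξ : V →L[ℝ] ℂ) : covRe (c • ξ) = c.re • covRe ξ - c.im • covIm ξ := by
  ext; simp [covRe, covIm]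

theorem covIm_smul (c : ℂ) (ξ : V →L[ℝ] ℂ) : covIm (c • ξ) = c.re • covIm ξ + c.im • covRe ξ := by
  ext; simp [covRe, covIm]

theorem covRe_ofRealCov (p : V →L[ℝ] ℝ) : covRe (ofRealCov p) = p := by
  ext; simp [covRe, ofRealCov]

theorem covIm_ofRealCov (p : V →L[ℝ] ℝ) : covIm (ofRealCov p) = 0 := by
  ext; simp [covIm, ofRealCov]

variable (a : LinearMap.BilinForm ℝ (V →L[ℝ] ℝ))

theorem sesq_add_right (ξ η ζ : V →L[ℝ] ℂ) : sesq a ξ (η + ζ) = sesq a ξ η + sesq a ξ ζ := by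
  apply Complex.ext <;> simp [sesq, covRe_add, covIm_add] <;> ring

theorem sesq_smul_right (c : ℂ) (ξ η : V →L[ℝ] ℂ) :
    sesq a ξ (c • η) = (starRingEnd ℂ) c * sesq a ξ η := by
  apply Complex.ext <;> simp [sesq, covRe_smul, covIm_smul] <;> ring

theorem sesq_zero_right (ξ : V →L[ℝ] ℂ) : sesq a ξ 0 = 0 := by
  have h1 : covRe (0 : V →L[ℝ] ℂ) = 0 := by ext; simp [covRe]
  have h2 : covIm (0 : V →L[ℝ] ℂ) = 0 := by ext; simp [covIm]
  simp [sesq, h1, h2]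

theorem sesq_sub_right (ξ η ζ : V →L[ℝ] ℂ) : sesq a ξ (η - ζ) = sesq a ξ η - sesq a ξ ζ := by
  rw [sub_eq_add_neg, sesq_add_right, ← neg_one_smul ℂ ζ, sesq_smul_right]
  simp [sub_eq_add_neg]

theorem sesq_self_re (ξ : V →L[ℝ] ℂ) :
    (sesq a ξ ξ).re = a (covRe ξ) (covRe ξ) + a (covIm ξ) (covIm ξ) := by
  simp [sesq]

variable {a}

theorem sesq_self_nonneg (ha : ∀ ξ, 0 ≤ a ξ ξ) (ξ : V →L[ℝ] ℂ) : 0 ≤ (sesq a ξ ξ).re := by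
  rw [sesq_self_re]; exact add_nonneg (ha _) (ha _)

/-- Parallelogram law, with nonnegativity at `ξ - η`. -/
theorem sesq_add_self_le (ha : ∀ ξ, 0 ≤ a ξ ξ) (ξ η : V →L[ℝ] ℂ) :
    (sesq a (ξ + η) (ξ + η)).re ≤ 2 * (sesq a ξ ξ).re + 2 * (sesq a η η).re := by
  have h := sesq_self_nonneg ha (ξ + (-1 : ℂ) • η)
  rw [sesq_self_re] at h
  simp only [sesq_self_re, covRe_add, covIm_add, covRe_smul, covIm_smul] at h ⊢
  simp at h ⊢
  linarith

/-- Young's inequality for the form `sesq a`. -/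
theorem neg_two_mul_sesq_re_le (hs : ∀ ξ η, a ξ η = a η ξ) (ha : ∀ ξ, 0 ≤ a ξ ξ)
    (ξ : V →L[ℝ] ℂ) (p : V →L[ℝ] ℝ) (c : ℂ) (r : ℝ) {t : ℝ} (ht : 0 < t) :
    -(2 * r * (sesq a ξ (c • ofRealCov p)).re)
      ≤ t * (r ^ 2 * (sesq a ξ ξ).re) + t⁻¹ * (‖c‖ ^ 2 * a p p) := by
  -- Nonnegativity on the real and imaginary parts of `t r ξ + c p`; the sum, divided by `t`, is the
  -- claim.
  have h1 := ha ((t * r) • covRe ξ + c.re • p)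
  have h2 := ha ((t * r) • covIm ξ + c.im • p)
  have e : (sesq a ξ (c • ofRealCov p)).re
      = c.re * a (covRe ξ) p + c.im * a (covIm ξ) p := by
    simp [sesq, covRe_smul, covIm_smul, covRe_ofRealCov, covIm_ofRealCov]
  simp only [map_add, map_smul, LinearMap.add_apply, LinearMap.smul_apply, smul_eq_mul,
    hs p] at h1 h2
  rw [e, sesq_self_re, ← Complex.normSq_eq_norm_sq, Complex.normSq_apply]
  have h3 : 0 ≤ t⁻¹ * (t * r * (t * r * a (covRe ξ) (covRe ξ) + c.re * a (covRe ξ) p)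
      + c.re * (t * r * a (covRe ξ) p + c.re * a p p)
      + (t * r * (t * r * a (covIm ξ) (covIm ξ) + c.im * a (covIm ξ) p)
      + c.im * (t * r * a (covIm ξ) p + c.im * a p p))) :=
    mul_nonneg (inv_nonneg.2 ht.le) (by linarith)
  have h4 : t⁻¹ * t = 1 := inv_mul_cancel₀ ht.ne'
  have h5 : t⁻¹ * (t * r * (t * r * a (covRe ξ) (covRe ξ) + c.re * a (covRe ξ) p)
      + c.re * (t * r * a (covRe ξ) p + c.re * a p p)
      + (t * r * (t * r * a (covIm ξ) (covIm ξ) + c.im * a (covIm ξ) p)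
      + c.im * (t * r * a (covIm ξ) p + c.im * a p p)))
      = (t⁻¹ * t) * (t * r ^ 2 * (a (covRe ξ) (covRe ξ) + a (covIm ξ) (covIm ξ))
        + 2 * r * (c.re * a (covRe ξ) p + c.im * a (covIm ξ) p))
        + t⁻¹ * ((c.re * c.re + c.im * c.im) * a p p) := by ring
  rw [h5, h4] at h3
  linarith

theorem sesq_comp {V' : Type*} [AddCommGroup V'] [Module ℝ V'] [TopologicalSpace V']
    {b : LinearMap.BilinForm ℝ (V' →L[ℝ] ℝ)} (L : V →L[ℝ] V')
    (h : ∀ η ζ, b η ζ = a (η.comp L) (ζ.comp L)) (η ζ : V' →L[ℝ] ℂ) :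
    sesq b η ζ = sesq a (η.comp L) (ζ.comp L) := by
  simp only [sesq, h]; rfl

end Sesquilinear

/-! ### Norm bound for the sesquilinear extension. -/

section NormedSesquilinear

variable {V : Type*} [NormedAddCommGroup V] [NormedSpace ℝ V]

theorem norm_covRe_le (ξ : V →L[ℝ] ℂ) : ‖covRe ξ‖ ≤ ‖ξ‖ := by
  refine (ContinuousLinearMap.opNorm_comp_le _ _).trans ?_
  simp

theorem norm_covIm_le (ξ : V →L[ℝ] ℂ) : ‖covIm ξ‖ ≤ ‖ξ‖ := by
  refine (ContinuousLinearMap.opNorm_comp_le _ _).trans ?_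
  simp

/-- Cauchy–Schwarz for a nonnegative symmetric form bounds each of the four real terms by `c ‖ξ‖
‖η‖`, whence the factor 4. -/
theorem norm_sesq_le {a : LinearMap.BilinForm ℝ (V →L[ℝ] ℝ)} (hs : ∀ ξ η, a ξ η = a η ξ)
    (ha : ∀ ξ, 0 ≤ a ξ ξ) {c : ℝ} (hc : 0 ≤ c) (hac : ∀ ξ, a ξ ξ ≤ c * ‖ξ‖ ^ 2)
    (ξ η : V →L[ℝ] ℂ) : ‖sesq a ξ η‖ ≤ 4 * c * (‖ξ‖ * ‖η‖) := by
  have key : ∀ p q : V →L[ℝ] ℝ, ‖p‖ ≤ ‖ξ‖ → ‖q‖ ≤ ‖η‖ → |a p q| ≤ c * (‖ξ‖ * ‖η‖) := by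
    intro p q hp hq
    have hsym : LinearMap.IsSymm a := ⟨fun x y => by simp [hs x y]⟩
    have h := LinearMap.BilinForm.apply_sq_le_of_symm a ha hsym p q
    apply abs_le_of_sq_le_sq _ (by positivity)
    calc a p q ^ 2 ≤ a p p * a q q := h
      _ ≤ (c * ‖ξ‖ ^ 2) * (c * ‖η‖ ^ 2) := by
          refine mul_le_mul ((hac p).trans ?_) ((hac q).trans ?_) (ha q) (by positivity) <;> gcongr
      _ = _ := by ring
  have h1 := key _ _ (norm_covRe_le ξ) (norm_covRe_le η)
  have h2 := key _ _ (norm_covIm_le ξ) (norm_covIm_le η)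
  have h3 := key _ _ (norm_covIm_le ξ) (norm_covRe_le η)
  have h4 := key _ _ (norm_covRe_le ξ) (norm_covIm_le η)
  refine (Complex.norm_le_abs_re_add_abs_im _).trans ?_
  have e1 : (sesq a ξ η).re = a (covRe ξ) (covRe η) + a (covIm ξ) (covIm η) := by simp [sesq]
  have e2 : (sesq a ξ η).im = a (covIm ξ) (covRe η) - a (covRe ξ) (covIm η) := by simp [sesq]
  rw [e1, e2]
  have := abs_add_le (a (covRe ξ) (covRe η)) (a (covIm ξ) (covIm η))
  have := abs_sub (a (covIm ξ) (covRe η)) (a (covRe ξ) (covIm η))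
  linarith

end NormedSesquilinear

/-! ### Transfer of coefficients, measures and integrability between charts and the manifold. -/

section Charts

variable {d : ℕ} {Ω : Type*} [TopologicalSpace Ω] [ChartedSpace (EuclideanSpace ℝ (Fin d)) Ω]

local notation "𝔼" => EuclideanSpace ℝ (Fin d)

/-- The coefficient field in a chart, as a bilinear form. -/
noncomputable def CoefficientField.chartForm (A : CoefficientField d Ω)
    (e : OpenPartialHomeomorph Ω 𝔼) (y : 𝔼) : LinearMap.BilinForm ℝ (𝔼 →L[ℝ] ℝ) :=
  LinearMap.mk₂ ℝ (A.inChart e y)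
    (fun _ _ _ => by
      simp only [CoefficientField.inChart]
      erw [ContinuousLinearMap.add_comp, map_add]; rfl)
    (fun _ _ _ => by
      simp only [CoefficientField.inChart]
      erw [ContinuousLinearMap.smul_comp, map_smul]; rfl)
    (fun _ _ _ => by
      simp only [CoefficientField.inChart]
      erw [ContinuousLinearMap.add_comp, map_add])
    (fun _ _ _ => by
      simp only [CoefficientField.inChart]
      erw [ContinuousLinearMap.smul_comp, map_smul])

theorem CoefficientField.chartForm_apply (A : CoefficientField d Ω)
    (e : OpenPartialHomeomorph Ω 𝔼) (y : 𝔼) (η ζ : 𝔼 →L[ℝ] ℝ) :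
    A.chartForm e y η ζ = A.inChart e y η ζ := rfl

section Smooth

variable [IsManifold (𝓡 d) ∞ Ω]

theorem mfderiv_symm_mfderiv {e : OpenPartialHomeomorph Ω 𝔼} (he : e ∈ atlas 𝔼 Ω) {y : 𝔼}
    (hy : y ∈ e.target) (w : TangentSpace (𝓡 d) (e.symm y)) :
    mfderiv (𝓡 d) (𝓡 d) e.symm y (mfderiv (𝓡 d) (𝓡 d) e (e.symm y) w) = w := by
  have : IsManifold (𝓡 d) 1 Ω := IsManifold.of_le (n := ∞) (by norm_num)
  have h := (mdifferentiable_of_mem_atlas (I := 𝓡 d) he).symm_comp_deriv (e.map_target hy)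
  -- The chain rule gives the derivative of `e.symm` at `e (e.symm y)`, whose tangent space depends
  -- on that point. `M` has fixed types, so the point may be replaced by `y`.
  let M : 𝔼 → 𝔼 → 𝔼 := fun z v => mfderiv (𝓡 d) (𝓡 d) e.symm z v
  have hz : M (e (e.symm y)) = M y := congrArg M (e.right_inv hy)
  exact (congrFun hz (mfderiv (𝓡 d) (𝓡 d) e (e.symm y) w)).symm.trans
    (congrArg (fun L => L w) h)

theorem CovectorField.inChart_comp (F : CovectorField d Ω) {e : OpenPartialHomeomorph Ω 𝔼}
    (he : e ∈ atlas 𝔼 Ω) {y : 𝔼} (hy : y ∈ e.target) :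
    (F.inChart e y).comp (mfderiv (𝓡 d) (𝓡 d) e (e.symm y)) = F (e.symm y) := by
  ext w
  exact congrArg (F (e.symm y)) (mfderiv_symm_mfderiv he hy w)

theorem sesq_symm_eq (A : CoefficientField d Ω) (F G : CovectorField d Ω)
    {e : OpenPartialHomeomorph Ω 𝔼} (he : e ∈ atlas 𝔼 Ω) {y : 𝔼} (hy : y ∈ e.target) :
    sesq (A (e.symm y)) (F (e.symm y)) (G (e.symm y))
      = sesq (A.chartForm e y) (F.inChart e y) (G.inChart e y) := by
  have h := sesq_comp (V := TangentSpace (𝓡 d) (e.symm y)) (V' := 𝔼) (a := A (e.symm y))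
    (b := A.chartForm e y) (mfderiv (𝓡 d) (𝓡 d) e (e.symm y)) (fun _ _ => rfl)
    (F.inChart e y) (G.inChart e y)
  rw [h]
  exact congrArg₂ (sesq (A (e.symm y))) (F.inChart_comp he hy).symm (G.inChart_comp he hy).symm

/-- Ellipticity on the one-point compact set `{y}` suffices, since every covector at `x` is the
pull-back of a coordinate covector. -/
theorem IsLocallyElliptic.nonneg {A : CoefficientField d Ω} (hA : IsLocallyElliptic A) (x : Ω)
    (ξ : TangentSpace (𝓡 d) x →L[ℝ] ℝ) : 0 ≤ A x ξ ξ := by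
  obtain ⟨e, he, y, hy, rfl⟩ : ∃ e ∈ atlas 𝔼 Ω, ∃ y ∈ e.target, e.symm y = x :=
    ⟨chartAt 𝔼 x, chart_mem_atlas _ _, chartAt 𝔼 x x, mem_chart_target _ _,
      (chartAt 𝔼 x).left_inv (mem_chart_source _ _)⟩
  obtain ⟨c, hc, h⟩ := hA.elliptic e he {y} (singleton_subset_iff.2 hy) isCompact_singleton
  set η : 𝔼 →L[ℝ] ℝ := ξ.comp (mfderiv (𝓡 d) (𝓡 d) e.symm y)
  have h1 := (h y rfl η).1
  have h2 : η.comp (mfderiv (𝓡 d) (𝓡 d) e (e.symm y)) = ξ := by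
    ext w
    exact congrArg ξ (mfderiv_symm_mfderiv he hy w)
  rw [CoefficientField.inChart, h2] at h1
  exact le_trans (by positivity) h1

end Smooth

theorem IsLocallyElliptic.chartForm_symm {A : CoefficientField d Ω} (hA : IsLocallyElliptic A)
    (e : OpenPartialHomeomorph Ω 𝔼) (y : 𝔼) (η ζ : 𝔼 →L[ℝ] ℝ) :
    A.chartForm e y η ζ = A.chartForm e y ζ η := hA.symm _ _ _

theorem IsLocallyElliptic.exists_norm_sesq_le {A : CoefficientField d Ω}
    (hA : IsLocallyElliptic A) {e : OpenPartialHomeomorph Ω 𝔼} (he : e ∈ atlas 𝔼 Ω) {K : Set 𝔼}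
    (hKt : K ⊆ e.target) (hK : IsCompact K) :
    ∃ c : ℝ, 0 ≤ c ∧ ∀ y ∈ K, ∀ ξ η : 𝔼 →L[ℝ] ℂ,
      ‖sesq (A.chartForm e y) ξ η‖ ≤ c * (‖ξ‖ * ‖η‖) := by
  obtain ⟨c, hc, h⟩ := hA.elliptic e he K hKt hK
  refine ⟨4 * c, by positivity, fun y hy ξ η => ?_⟩
  refine norm_sesq_le (hA.chartForm_symm e y) (fun ξ => ?_) (by positivity)
    (fun ξ => (h y hy ξ).2) ξ η
  exact le_trans (by positivity) (h y hy ξ).1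

theorem covector_eq_sum (ξ : 𝔼 →L[ℝ] ℝ) :
    ξ = ∑ i, ξ (EuclideanSpace.single i 1) • (EuclideanSpace.proj i : 𝔼 →L[ℝ] ℝ) := by
  refine ContinuousLinearMap.coe_injective ((EuclideanSpace.basisFun (Fin d) ℝ).toBasis.ext ?_)
  intro i
  simp

/-- Measurability is given for fixed covectors; expansion in the coordinate covectors extends it to
measurable fields. -/
theorem IsLocallyElliptic.aemeasurable_chartForm {A : CoefficientField d Ω}
    (hA : IsLocallyElliptic A) {e : OpenPartialHomeomorph Ω 𝔼} (he : e ∈ atlas 𝔼 Ω) {K : Set 𝔼}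
    (hKt : K ⊆ e.target) {f g : 𝔼 → 𝔼 →L[ℝ] ℝ}
    (hf : AEStronglyMeasurable f (volume.restrict K))
    (hg : AEStronglyMeasurable g (volume.restrict K)) :
    AEMeasurable (fun y => A.chartForm e y (f y) (g y)) (volume.restrict K) := by
  have e1 : (fun y => A.chartForm e y (f y) (g y)) = fun y => ∑ i, ∑ j,
      f y (EuclideanSpace.single i 1) * (g y (EuclideanSpace.single j 1) *
        A.inChart e y (EuclideanSpace.proj i) (EuclideanSpace.proj j)) := by
    funext y
    conv_lhs => rw [covector_eq_sum (f y), covector_eq_sum (g y)]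
    simp only [map_sum, LinearMap.sum_apply, map_smul, LinearMap.smul_apply, smul_eq_mul,
      CoefficientField.chartForm_apply, Finset.mul_sum]
    rw [Finset.sum_comm]
    exact Finset.sum_congr rfl fun i _ => Finset.sum_congr rfl fun j _ => by ring
  rw [e1]
  refine Finset.aemeasurable_fun_sum _ fun i _ => Finset.aemeasurable_fun_sum _ fun j _ => ?_
  refine AEMeasurable.mul ?_ (AEMeasurable.mul ?_ ?_)
  · exact ((ContinuousLinearMap.apply ℝ ℝ
      (EuclideanSpace.single i (1 : ℝ))).continuous.comp_aestronglyMeasurable hf).aemeasurable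
  · exact ((ContinuousLinearMap.apply ℝ ℝ
      (EuclideanSpace.single j (1 : ℝ))).continuous.comp_aestronglyMeasurable hg).aemeasurable
  · exact (hA.measurable e he _ _).mono_measure (Measure.restrict_mono hKt le_rfl)

theorem IsLocallyElliptic.aestronglyMeasurable_sesq {A : CoefficientField d Ω}
    (hA : IsLocallyElliptic A) {e : OpenPartialHomeomorph Ω 𝔼} (he : e ∈ atlas 𝔼 Ω) {K : Set 𝔼}
    (hKt : K ⊆ e.target) {f g : 𝔼 → 𝔼 →L[ℝ] ℂ}
    (hf : AEStronglyMeasurable f (volume.restrict K))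
    (hg : AEStronglyMeasurable g (volume.restrict K)) :
    AEStronglyMeasurable (fun y => sesq (A.chartForm e y) (f y) (g y)) (volume.restrict K) := by
  have hre : ∀ {f : 𝔼 → 𝔼 →L[ℝ] ℂ}, AEStronglyMeasurable f (volume.restrict K) →
      AEStronglyMeasurable (fun y => covRe (f y)) (volume.restrict K) := fun hf =>
    (continuous_const.clm_comp continuous_id).comp_aestronglyMeasurable hf
  have him : ∀ {f : 𝔼 → 𝔼 →L[ℝ] ℂ}, AEStronglyMeasurable f (volume.restrict K) →
      AEStronglyMeasurable (fun y => covIm (f y)) (volume.restrict K) := fun hf =>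
    (continuous_const.clm_comp continuous_id).comp_aestronglyMeasurable hf
  have h1 := hA.aemeasurable_chartForm he hKt (hre hf) (hre hg)
  have h2 := hA.aemeasurable_chartForm he hKt (him hf) (him hg)
  have h3 := hA.aemeasurable_chartForm he hKt (him hf) (hre hg)
  have h4 := hA.aemeasurable_chartForm he hKt (hre hf) (him hg)
  exact ((Complex.measurable_ofReal.comp_aemeasurable (h1.add h2)).add
    ((Complex.measurable_ofReal.comp_aemeasurable (h3.sub h4)).mul_const _)).aestronglyMeasurable

section Transfer

variable [MeasurableSpace Ω] [BorelSpace Ω] {μ : Measure Ω}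

omit [ChartedSpace 𝔼 Ω] in
theorem aemeasurable_chart (e : OpenPartialHomeomorph Ω 𝔼) (K : Set 𝔼) :
    AEMeasurable e (μ.restrict (e.source ∩ e ⁻¹' K)) :=
  (e.continuousOn.aemeasurable e.open_source.measurableSet).mono_measure
    (Measure.restrict_mono inter_subset_left le_rfl)

/-- The local bound on the density dominates `μ` by Lebesgue measure on compact parts of a chart, so
that estimates in coordinates yield estimates for `μ`. -/
theorem HasPositiveDensity.exists_map_le (hμ : HasPositiveDensity d μ)
    {e : OpenPartialHomeomorph Ω 𝔼} (he : e ∈ atlas 𝔼 Ω) {K : Set 𝔼}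
    (hKt : K ⊆ e.target) (hK : IsCompact K) :
    ∃ C : ℝ, (μ.restrict (e.source ∩ e ⁻¹' K)).map e ≤ ENNReal.ofReal C • volume.restrict K := by
  obtain ⟨m, hm, -, hb, hmap⟩ := hμ e he
  obtain ⟨C, hC⟩ := hb K hKt hK
  refine ⟨C, ?_⟩
  have hme : AEMeasurable e (μ.restrict e.source) :=
    e.continuousOn.aemeasurable e.open_source.measurableSet
  rw [inter_comm, ← Measure.restrict_restrict' e.open_source.measurableSet,
    ← Measure.restrict_map_of_aemeasurable hme hK.measurableSet, hmap,
    restrict_withDensity hK.measurableSet, Measure.restrict_restrict hK.measurableSet,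
    inter_eq_self_of_subset_left hKt, ← withDensity_const]
  refine withDensity_mono ?_
  filter_upwards [ae_restrict_mem hK.measurableSet] with y hy
  exact ENNReal.ofReal_le_ofReal (hC y hy)

theorem HasPositiveDensity.exists_lintegral_le (hμ : HasPositiveDensity d μ)
    {e : OpenPartialHomeomorph Ω 𝔼} (he : e ∈ atlas 𝔼 Ω) {K : Set 𝔼}
    (hKt : K ⊆ e.target) (hK : IsCompact K) :
    ∃ C : ℝ, ∀ h : 𝔼 → ENNReal, AEMeasurable h (volume.restrict K) →
      ∫⁻ x in e.source ∩ e ⁻¹' K, h (e x) ∂μ ≤ ENNReal.ofReal C * ∫⁻ y in K, h y := by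
  obtain ⟨C, hC⟩ := hμ.exists_map_le he hKt hK
  refine ⟨C, fun h hh => ?_⟩
  rw [← lintegral_map' ((hh.smul_measure (ENNReal.ofReal C)).mono_measure hC)
    (aemeasurable_chart e K), ← smul_eq_mul, ← lintegral_smul_measure]
  exact lintegral_mono' hC le_rfl

omit [ChartedSpace 𝔼 Ω] in
theorem measurableSet_chart_preimage (e : OpenPartialHomeomorph Ω 𝔼) {K : Set 𝔼}
    (hK : IsCompact K) : MeasurableSet (e.source ∩ e ⁻¹' K) := by
  have h : e.source ∩ e ⁻¹' K = e.source \ (e.source ∩ e ⁻¹' Kᶜ) := by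
    ext x; simp +contextual
  rw [h]
  exact e.open_source.measurableSet.diff
    (e.isOpen_inter_preimage hK.isClosed.isOpen_compl).measurableSet

theorem HasPositiveDensity.integrableOn_of_chart (hμ : HasPositiveDensity d μ)
    {e : OpenPartialHomeomorph Ω 𝔼} (he : e ∈ atlas 𝔼 Ω) {K : Set 𝔼}
    (hKt : K ⊆ e.target) (hK : IsCompact K) {G : Type*} [NormedAddCommGroup G] {f : Ω → G}
    (hf : IntegrableOn (fun y => f (e.symm y)) K volume) :
    IntegrableOn f (e.source ∩ e ⁻¹' K) μ := by
  obtain ⟨C, hC⟩ := hμ.exists_map_le he hKt hK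
  have h1 : Integrable (fun y => f (e.symm y)) ((μ.restrict (e.source ∩ e ⁻¹' K)).map e) :=
    (Integrable.smul_measure hf ENNReal.ofReal_ne_top).mono_measure hC
  refine (h1.comp_aemeasurable (aemeasurable_chart e K)).congr ?_
  filter_upwards [ae_restrict_mem (measurableSet_chart_preimage e hK)] with x hx
  simp [e.left_inv hx.1]

theorem HasPositiveDensity.locallyIntegrable_of_charts (hμ : HasPositiveDensity d μ)
    {G : Type*} [NormedAddCommGroup G] {f : Ω → G}
    (hf : ∀ e ∈ atlas 𝔼 Ω, ∀ K ⊆ e.target, IsCompact K →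
      IntegrableOn (fun y => f (e.symm y)) K volume) :
    LocallyIntegrable f μ := by
  intro x
  set e := chartAt 𝔼 x
  have hx : x ∈ e.source := mem_chart_source _ _
  obtain ⟨K, hK, hKt, hKc⟩ := local_compact_nhds (e.open_target.mem_nhds (e.map_source hx))
  refine ⟨e.source ∩ e ⁻¹' K, ?_, ?_⟩
  · exact inter_mem (e.open_source.mem_nhds hx) ((e.continuousAt hx).preimage_mem_nhds hK)
  · exact hμ.integrableOn_of_chart (chart_mem_atlas _ _) hKt hKc (hf _ (chart_mem_atlas _ _) K hKt hKc)

/-- A covector field which is locally square integrable in every chart. -/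
def CovectorField.IsLocallyL2 (F : CovectorField d Ω) : Prop :=
  ∀ e ∈ atlas 𝔼 Ω, ∀ K ⊆ e.target, IsCompact K →
    MemLp (fun y => F.inChart e y) 2 (volume.restrict K)

variable [IsManifold (𝓡 d) ∞ Ω]

omit [MeasurableSpace Ω] [BorelSpace Ω] in
theorem IsLocallyElliptic.integrableOn_sesq {A : CoefficientField d Ω}
    (hA : IsLocallyElliptic A) {e : OpenPartialHomeomorph Ω 𝔼} (he : e ∈ atlas 𝔼 Ω) {K : Set 𝔼}
    (hKt : K ⊆ e.target) (hK : IsCompact K) {F G : CovectorField d Ω}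
    (hF : MemLp (fun y => F.inChart e y) 2 (volume.restrict K))
    (hG : MemLp (fun y => G.inChart e y) 2 (volume.restrict K)) :
    IntegrableOn (fun y => sesq (A (e.symm y)) (F (e.symm y)) (G (e.symm y))) K volume := by
  obtain ⟨c, hc, hb⟩ := hA.exists_norm_sesq_le he hKt hK
  have h1 : Integrable (fun y => c * (‖F.inChart e y‖ * ‖G.inChart e y‖)) (volume.restrict K) :=
    (hF.norm.integrable_mul hG.norm).const_mul c
  have h2 : Integrable (fun y => sesq (A.chartForm e y) (F.inChart e y) (G.inChart e y))
      (volume.restrict K) := by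
    refine h1.mono' (hA.aestronglyMeasurable_sesq he hKt hF.1 hG.1) ?_
    filter_upwards [ae_restrict_mem hK.measurableSet] with y hy using hb y hy _ _
  refine Integrable.congr h2 ?_
  filter_upwards [ae_restrict_mem hK.measurableSet] with y hy
  exact (sesq_symm_eq A F G he (hKt hy)).symm

theorem IsLocallyElliptic.locallyIntegrable_sesq (hμ : HasPositiveDensity d μ)
    {A : CoefficientField d Ω} (hA : IsLocallyElliptic A) {F G : CovectorField d Ω}
    (hF : F.IsLocallyL2) (hG : G.IsLocallyL2) :
    LocallyIntegrable (fun x => sesq (A x) (F x) (G x)) μ :=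
  hμ.locallyIntegrable_of_charts fun e he K hKt hK =>
    hA.integrableOn_sesq he hKt hK (hF e he K hKt hK) (hG e he K hKt hK)

end Transfer

end Charts

/-! ### Continuous functions on compact sets are in every `L^p`. -/

section LocalBounds

variable {E F : Type*} [NormedAddCommGroup E] [MeasurableSpace E] [BorelSpace E]
  [NormedAddCommGroup F] {ν : Measure E} [IsFiniteMeasureOnCompacts ν]

theorem memLp_of_continuousOn [SecondCountableTopologyEither E F] {K : Set E} (hK : IsCompact K)
    {f : E → F} (hf : ContinuousOn f K)
    (p : ENNReal) : MemLp f p (ν.restrict K) := by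
  have : IsFiniteMeasure (ν.restrict K) := ⟨by simpa using hK.measure_lt_top⟩
  obtain ⟨C, hC⟩ := hK.exists_bound_of_continuousOn hf
  refine MemLp.of_bound (hf.aestronglyMeasurable_of_isCompact hK hK.measurableSet) C ?_
  filter_upwards [ae_restrict_mem hK.measurableSet] with y hy using hC y hy

end LocalBounds

/-! ### Smooth functions and their differentials in charts; the product `ρ u`. -/

section SmoothTransfer

variable {d : ℕ} {Ω : Type*} [TopologicalSpace Ω] [ChartedSpace (EuclideanSpace ℝ (Fin d)) Ω]

local notation "𝔼" => EuclideanSpace ℝ (Fin d)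

omit [ChartedSpace 𝔼 Ω] in
theorem isCompact_chart_preimage {e : OpenPartialHomeomorph Ω 𝔼} {K : Set 𝔼}
    (hKt : K ⊆ e.target) (hK : IsCompact K) : IsCompact (e.source ∩ e ⁻¹' K) := by
  rw [← e.symm_image_eq_source_inter_preimage hKt]
  exact hK.image_of_continuousOn (e.symm.continuousOn.mono hKt)

/-- A function on the coordinate space, carried to the manifold by a chart and extended by zero. -/
noncomputable def chartExtend {F : Type*} [Zero F] (e : OpenPartialHomeomorph Ω 𝔼) (f : 𝔼 → F) :
    Ω → F :=
  e.source.indicator fun x => f (e x)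

omit [ChartedSpace 𝔼 Ω] in
theorem chartExtend_symm {F : Type*} [Zero F] (e : OpenPartialHomeomorph Ω 𝔼) (f : 𝔼 → F)
    {y : 𝔼} (hy : y ∈ e.target) : chartExtend e f (e.symm y) = f y := by
  rw [chartExtend, indicator_of_mem (e.map_target hy), e.right_inv hy]

omit [ChartedSpace 𝔼 Ω] in
theorem chartExtend_eq_zero {F : Type*} [Zero F] {e : OpenPartialHomeomorph Ω 𝔼} {f : 𝔼 → F}
    {K : Set 𝔼} (hf : ∀ y ∉ K, f y = 0) {x : Ω} (hx : x ∉ e.source ∩ e ⁻¹' K) :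
    chartExtend e f x = 0 := by
  by_cases h : x ∈ e.source
  · rw [chartExtend, indicator_of_mem h]
    exact hf _ fun h2 => hx ⟨h, h2⟩
  · rw [chartExtend, indicator_of_notMem h]

omit [ChartedSpace 𝔼 Ω] in
theorem tsupport_chartExtend_subset [T2Space Ω] {F : Type*} [Zero F]
    {e : OpenPartialHomeomorph Ω 𝔼}
    {f : 𝔼 → F} {K : Set 𝔼} (hKt : K ⊆ e.target) (hK : IsCompact K) (hf : ∀ y ∉ K, f y = 0) :
    tsupport (chartExtend e f) ⊆ e.source ∩ e ⁻¹' K :=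
  closure_minimal (fun _ hx => by_contra fun h => hx (chartExtend_eq_zero hf h))
    (isCompact_chart_preimage hKt hK).isClosed

omit [ChartedSpace 𝔼 Ω] in
theorem hasCompactSupport_chartExtend [T2Space Ω] {F : Type*} [Zero F]
    {e : OpenPartialHomeomorph Ω 𝔼}
    {f : 𝔼 → F} {K : Set 𝔼} (hKt : K ⊆ e.target) (hK : IsCompact K) (hf : ∀ y ∉ K, f y = 0) :
    HasCompactSupport (chartExtend e f) :=
  HasCompactSupport.intro (isCompact_chart_preimage hKt hK) fun _ hx => chartExtend_eq_zero hf hx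

section

variable {F : Type*} [NormedAddCommGroup F] [NormedSpace ℝ F]

theorem mfderiv_eq_zero_of_notMem_tsupport {v : Ω → F} {x : Ω} (hx : x ∉ tsupport v) :
    mfderiv (𝓡 d) 𝓘(ℝ, F) v x = 0 := by
  have h := (notMem_tsupport_iff_eventuallyEq.1 hx).mfderiv_eq (I := 𝓡 d) (I' := 𝓘(ℝ, F))
  rw [h]
  exact mfderiv_const

variable [IsManifold (𝓡 d) ∞ Ω]

theorem contMDiff_chartExtend [T2Space Ω] {e : OpenPartialHomeomorph Ω 𝔼} (he : e ∈ atlas 𝔼 Ω)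
    {f : 𝔼 → F} (hfs : ContDiff ℝ ∞ f) {K : Set 𝔼} (hKt : K ⊆ e.target) (hK : IsCompact K)
    (hf : ∀ y ∉ K, f y = 0) : ContMDiff (𝓡 d) 𝓘(ℝ, F) ∞ (chartExtend e f) := by
  refine contMDiff_of_tsupport fun x hx => ?_
  have hxs : x ∈ e.source := (tsupport_chartExtend_subset hKt hK hf hx).1
  have h1 : ContMDiffAt (𝓡 d) 𝓘(ℝ, F) ∞ (fun x => f (e x)) x :=
    hfs.contMDiff.contMDiffAt.comp x
      (contMDiffAt_of_mem_maximalAtlas (IsManifold.subset_maximalAtlas he) hxs)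
  refine h1.congr_of_eventuallyEq ?_
  filter_upwards [e.open_source.mem_nhds hxs] with z hz
  rw [chartExtend, indicator_of_mem hz]

theorem contDiffOn_symm {e : OpenPartialHomeomorph Ω 𝔼} (he : e ∈ atlas 𝔼 Ω) {v : Ω → F}
    (hv : ContMDiff (𝓡 d) 𝓘(ℝ, F) ∞ v) : ContDiffOn ℝ ∞ (fun y => v (e.symm y)) e.target := by
  rw [← contMDiffOn_iff_contDiffOn]
  exact hv.comp_contMDiffOn
    (contMDiffOn_symm_of_mem_maximalAtlas (IsManifold.subset_maximalAtlas he))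

theorem mfderiv_comp_symm {e : OpenPartialHomeomorph Ω 𝔼} (he : e ∈ atlas 𝔼 Ω) {v : Ω → F}
    (hv : ContMDiff (𝓡 d) 𝓘(ℝ, F) ∞ v) {y : 𝔼} (hy : y ∈ e.target) :
    fderiv ℝ (fun y => v (e.symm y)) y
      = (mfderiv (𝓡 d) 𝓘(ℝ, F) v (e.symm y)).comp (mfderiv (𝓡 d) (𝓡 d) e.symm y) := by
  have : IsManifold (𝓡 d) 1 Ω := IsManifold.of_le (n := ∞) (by norm_num)
  rw [← mfderiv_eq_fderiv]
  exact mfderiv_comp y (hv.mdifferentiable (by norm_num) _)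
    ((mdifferentiable_of_mem_atlas (I := 𝓡 d) he).mdifferentiableAt_symm hy)

/-- A smooth function with compact support in a chart, in the coordinates of the chart. -/
theorem contDiff_indicator_symm {e : OpenPartialHomeomorph Ω 𝔼} (he : e ∈ atlas 𝔼 Ω) {ρ : Ω → F}
    (hρ : ContMDiff (𝓡 d) 𝓘(ℝ, F) ∞ ρ) (hρc : HasCompactSupport ρ)
    (hρs : tsupport ρ ⊆ e.source) :
    ∃ ψ : 𝔼 → F, ContDiff ℝ ∞ ψ ∧ HasCompactSupport ψ ∧ tsupport ψ ⊆ e.target ∧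
      (∀ y ∈ e.target, ψ y = ρ (e.symm y)) ∧ ∀ x ∉ e.source ∩ e ⁻¹' (tsupport ψ), ρ x = 0 := by
  set ψ : 𝔼 → F := e.target.indicator fun y => ρ (e.symm y)
  -- This image is compact, hence closed in the whole coordinate space, so the extension by zero is
  -- smooth across the boundary of `e.target`.
  set K := e '' tsupport ρ
  have hK : IsCompact K := hρc.isCompact.image_of_continuousOn (e.continuousOn.mono hρs)
  have hKt : K ⊆ e.target := by
    rintro _ ⟨x, hx, rfl⟩; exact e.map_source (hρs hx)
  have hψt : ∀ y ∈ e.target, ψ y = ρ (e.symm y) := fun y hy => indicator_of_mem hy _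
  have hψ : ∀ y ∉ K, ψ y = 0 := by
    intro y hy
    by_cases hyt : y ∈ e.target
    · rw [hψt y hyt]
      refine image_eq_zero_of_notMem_tsupport fun h => hy ⟨_, h, e.right_inv hyt⟩
    · exact indicator_of_notMem hyt _
  have hsub : tsupport ψ ⊆ K :=
    closure_minimal (fun y hy => by_contra fun h => hy (hψ y h)) hK.isClosed
  refine ⟨ψ, ?_, HasCompactSupport.intro hK fun y hy => hψ y hy, hsub.trans hKt,
    hψt, ?_⟩
  · rw [← contMDiff_iff_contDiff]
    refine contMDiff_of_tsupport fun y hy => ?_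
    have hyt := hKt (hsub hy)
    have h1 := ((contDiffOn_symm he hρ).contDiffAt (e.open_target.mem_nhds hyt)).contMDiffAt
    refine h1.congr_of_eventuallyEq ?_
    filter_upwards [e.open_target.mem_nhds hyt] with z hz using hψt z hz
  · intro x hx
    by_contra h
    have hxs : x ∈ e.source := hρs (subset_tsupport _ h)
    refine hx ⟨hxs, subset_tsupport _ ?_⟩
    rw [Function.mem_support, hψt _ (e.map_source hxs), e.left_inv hxs]
    exact h

end

section

variable [IsManifold (𝓡 d) ∞ Ω]

theorem differential_inChart {e : OpenPartialHomeomorph Ω 𝔼} (he : e ∈ atlas 𝔼 Ω) {v : Ω → ℂ}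
    (hv : ContMDiff (𝓡 d) 𝓘(ℝ, ℂ) ∞ v) {y : 𝔼} (hy : y ∈ e.target) :
    (differential d v).inChart e y = fderiv ℝ (fun y => v (e.symm y)) y :=
  (mfderiv_comp_symm he hv hy).symm

theorem isLocallyL2_differential {v : Ω → ℂ} (hv : ContMDiff (𝓡 d) 𝓘(ℝ, ℂ) ∞ v) :
    (differential d v).IsLocallyL2 := by
  intro e he K hKt hK
  have hc := ((contDiffOn_symm he hv).continuousOn_fderiv_of_isOpen e.open_target
    (by norm_num)).mono hKt
  refine (memLp_congr_ae ?_).2 (memLp_of_continuousOn (ν := volume) hK hc 2)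
  filter_upwards [ae_restrict_mem hK.measurableSet] with y hy
  exact differential_inChart he hv (hKt hy)

end

/-- The differential of a real function. -/
noncomputable def realDifferential (ρ : Ω → ℝ) (x : Ω) : TangentSpace (𝓡 d) x →L[ℝ] ℝ :=
  mfderiv (𝓡 d) 𝓘(ℝ, ℝ) ρ x

/-- The weak differential of `ρ * u`. -/
noncomputable def productDifferential (u : Ω → ℂ) (Du : CovectorField d Ω) (ρ : Ω → ℝ) :
    CovectorField d Ω :=
  fun x => (ρ x : ℂ) • Du x + u x • ofRealCov (realDifferential ρ x)

theorem productDifferential_eq_zero {u : Ω → ℂ} {Du : CovectorField d Ω} {ρ : Ω → ℝ} {x : Ω}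
    (hx : x ∉ tsupport ρ) : productDifferential u Du ρ x = 0 := by
  have h1 : ρ x = 0 := image_eq_zero_of_notMem_tsupport hx
  have h2 : realDifferential (d := d) ρ x = 0 := mfderiv_eq_zero_of_notMem_tsupport hx
  ext w
  simp [productDifferential, h1, h2, ofRealCov]

variable [IsManifold (𝓡 d) ∞ Ω]

theorem productDifferential_inChart (u : Ω → ℂ) (Du : CovectorField d Ω) {ρ : Ω → ℝ}
    (hρ : ContMDiff (𝓡 d) 𝓘(ℝ, ℝ) ∞ ρ) {e : OpenPartialHomeomorph Ω 𝔼} (he : e ∈ atlas 𝔼 Ω)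
    {y : 𝔼} (hy : y ∈ e.target) :
    (productDifferential u Du ρ).inChart e y = (ρ (e.symm y) : ℂ) • Du.inChart e y
      + u (e.symm y) • ofRealCov (fderiv ℝ (fun y => ρ (e.symm y)) y) := by
  rw [mfderiv_comp_symm he hρ hy]
  rfl

theorem continuous_ofRealCov {V : Type*} [NormedAddCommGroup V] [NormedSpace ℝ V] :
    Continuous (ofRealCov : (V →L[ℝ] ℝ) → V →L[ℝ] ℂ) :=
  continuous_const.clm_comp continuous_id

theorem memLp_smul_add_smul {K : Set 𝔼} (hK : IsCompact K) {u : 𝔼 → ℂ} {D : 𝔼 → 𝔼 →L[ℝ] ℂ}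
    (hu : MemLp u 2 (volume.restrict K)) (hD : MemLp D 2 (volume.restrict K)) {r : 𝔼 → ℝ}
    {r' : 𝔼 → 𝔼 →L[ℝ] ℝ} (hr : ContinuousOn r K) (hr' : ContinuousOn r' K) :
    MemLp (fun y => (r y : ℂ) • D y + u y • ofRealCov (r' y)) 2 (volume.restrict K) := by
  have h1 : MemLp (fun y => (r y : ℂ)) ⊤ (volume.restrict K) :=
    memLp_of_continuousOn hK (Complex.continuous_ofReal.comp_continuousOn hr) ⊤
  have h2 : MemLp (fun y => ofRealCov (r' y)) ⊤ (volume.restrict K) :=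
    memLp_of_continuousOn hK (continuous_ofRealCov.comp_continuousOn hr') ⊤
  exact (MemLp.smul (r := 2) hD h1).add (MemLp.smul (r := 2) h2 hu)

theorem isLocallyL2_productDifferential {u : Ω → ℂ} {Du : CovectorField d Ω}
    (hu : HasLocalWeakDifferential u Du) {ρ : Ω → ℝ} (hρ : ContMDiff (𝓡 d) 𝓘(ℝ, ℝ) ∞ ρ) :
    (productDifferential u Du ρ).IsLocallyL2 := by
  intro e he K hKt hK
  have hs := contDiffOn_symm he hρ
  refine (memLp_congr_ae ?_).2 (memLp_smul_add_smul hK (hu.memLp e he K hKt hK)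
    (hu.memLp_differential e he K hKt hK) (hs.continuousOn.mono hKt)
    ((hs.continuousOn_fderiv_of_isOpen e.open_target (by norm_num)).mono hKt))
  filter_upwards [ae_restrict_mem hK.measurableSet] with y hy
  exact productDifferential_inChart u Du hρ he (hKt hy)

end SmoothTransfer

/-! ### Limits of integrals over a chart. -/

section Convergence

variable {d : ℕ} {Ω : Type*} [TopologicalSpace Ω] [ChartedSpace (EuclideanSpace ℝ (Fin d)) Ω]
  [MeasurableSpace Ω] [BorelSpace Ω] {μ : Measure Ω}

local notation "𝔼" => EuclideanSpace ℝ (Fin d)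

theorem lintegral_enorm_mul_le {α F G : Type*} [MeasurableSpace α] [NormedAddCommGroup F]
    [NormedAddCommGroup G] {ν : Measure α} {f : α → F} {g : α → G}
    (hf : AEStronglyMeasurable f ν) (hg : AEStronglyMeasurable g ν) :
    ∫⁻ a, ‖f a‖ₑ * ‖g a‖ₑ ∂ν ≤ eLpNorm f 2 ν * eLpNorm g 2 ν := by
  have h := ENNReal.lintegral_mul_le_Lp_mul_Lq ν Real.HolderConjugate.two_two hf.enorm hg.enorm
  simpa [eLpNorm_eq_lintegral_rpow_enorm_toReal] using h

/-- Convergence to zero of integrals over a chart, from convergence to zero in `L²` in the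
coordinate space. -/
theorem HasPositiveDensity.tendsto_integral_zero (hμ : HasPositiveDensity d μ)
    {e : OpenPartialHomeomorph Ω 𝔼} (he : e ∈ atlas 𝔼 Ω) {K : Set 𝔼}
    (hKt : K ⊆ e.target) (hK : IsCompact K) {F G : Type*} [NormedAddCommGroup F]
    [NormedAddCommGroup G] {f : ℕ → Ω → ℂ} {h : 𝔼 → F} {g : ℕ → 𝔼 → G}
    (hh : MemLp h 2 (volume.restrict K))
    (hg : ∀ n, AEStronglyMeasurable (g n) (volume.restrict K))
    (hg0 : Tendsto (fun n => eLpNorm (g n) 2 volume) atTop (𝓝 0)) (c : ℝ)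
    (hf0 : ∀ n, ∀ x ∉ e.source ∩ e ⁻¹' K, f n x = 0)
    (hf : ∀ n, ∀ᵐ x ∂μ.restrict (e.source ∩ e ⁻¹' K), ‖f n x‖ ≤ c * (‖h (e x)‖ * ‖g n (e x)‖)) :
    Tendsto (fun n => ∫ x, f n x ∂μ) atTop (𝓝 0) := by
  obtain ⟨C, hC⟩ := hμ.exists_lintegral_le he hKt hK
  rw [tendsto_zero_iff_enorm_tendsto_zero]
  have hlim : Tendsto (fun n => ENNReal.ofReal C * (ENNReal.ofReal c *
      (eLpNorm h 2 (volume.restrict K) * eLpNorm (g n) 2 volume))) atTop (𝓝 0) := by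
    have h1 := ENNReal.Tendsto.const_mul (a := eLpNorm h 2 (volume.restrict K)) hg0
      (Or.inr hh.2.ne)
    have h2 := ENNReal.Tendsto.const_mul (a := ENNReal.ofReal c) h1 (Or.inr ENNReal.ofReal_ne_top)
    have h3 := ENNReal.Tendsto.const_mul (a := ENNReal.ofReal C) h2 (Or.inr ENNReal.ofReal_ne_top)
    simpa using h3
  refine tendsto_of_tendsto_of_tendsto_of_le_of_le tendsto_const_nhds hlim
    (fun _ => zero_le) fun n => ?_
  calc ‖∫ x, f n x ∂μ‖ₑ ≤ ∫⁻ x, ‖f n x‖ₑ ∂μ := enorm_integral_le_lintegral_enorm _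
    _ = ∫⁻ x in e.source ∩ e ⁻¹' K, ‖f n x‖ₑ ∂μ := by
        refine (setLIntegral_eq_of_support_subset ?_).symm
        intro x hx
        by_contra hxs
        exact hx (by simp [hf0 n x hxs])
    _ ≤ ∫⁻ x in e.source ∩ e ⁻¹' K, ENNReal.ofReal c * (‖h (e x)‖ₑ * ‖g n (e x)‖ₑ) ∂μ := by
        refine lintegral_mono_ae ?_
        filter_upwards [hf n] with x hx
        have := ENNReal.ofReal_le_ofReal hx
        rwa [ofReal_norm, ENNReal.ofReal_mul' (by positivity),
          ENNReal.ofReal_mul (norm_nonneg _), ofReal_norm, ofReal_norm] at this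
    -- The local bound on the density moves the integral to Lebesgue measure, where Cauchy–Schwarz
    -- applies.
    _ ≤ ENNReal.ofReal C * ∫⁻ y in K, ENNReal.ofReal c * (‖h y‖ₑ * ‖g n y‖ₑ) :=
        hC _ ((hh.1.enorm.mul (hg n).enorm).const_mul _)
    _ ≤ _ := by
        rw [lintegral_const_mul' _ _ ENNReal.ofReal_ne_top]
        gcongr
        refine (lintegral_enorm_mul_le hh.1 (hg n)).trans ?_
        gcongr
        exact Measure.restrict_le_self

end Convergence

/-! ### Weak product rule in coordinates. -/

section Euclidean

variable {d : ℕ}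

local notation "𝔼" => EuclideanSpace ℝ (Fin d)

theorem integrable_smul_of_support {F : Type*} [NormedAddCommGroup F] [NormedSpace ℝ F]
    {K : Set 𝔼} (hK : IsCompact K) {f : 𝔼 → F}
    (hf : IntegrableOn f K volume) {c : 𝔼 → ℝ} (hc : Continuous c) (h0 : ∀ y ∉ K, c y = 0) :
    Integrable (fun y => c y • f y) volume := by
  rw [← integrableOn_iff_integrable_of_support_subset (s := K)]
  · exact hf.continuousOn_smul hc.continuousOn hK
  · intro y hy
    by_contra h
    exact hy (by simp [h0 y h])

theorem memLp_of_support {F : Type*} [NormedAddCommGroup F] {K : Set 𝔼} (hK : IsCompact K)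
    {f : 𝔼 → F} (hf : MemLp f 2 (volume.restrict K)) (h0 : ∀ y ∉ K, f y = 0) :
    MemLp f 2 volume := by
  rw [← memLp_indicator_iff_restrict hK.measurableSet] at hf
  rwa [indicator_eq_self.2 fun y hy => by_contra fun h => hy (h0 y h)] at hf

theorem integrableOn_of_memLp {F : Type*} [NormedAddCommGroup F] {K : Set 𝔼} (hK : IsCompact K)
    {f : 𝔼 → F} (hf : MemLp f 2 (volume.restrict K)) : IntegrableOn f K volume := by
  have : IsFiniteMeasure (volume.restrict K) := ⟨by simpa using hK.measure_lt_top⟩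
  exact hf.integrable (by norm_num)

/-- The product rule for weak derivatives, in mollified form. -/
theorem fderiv_mollify_mul {T : Set 𝔼} {u : 𝔼 → ℂ} {D : 𝔼 → 𝔼 →L[ℝ] ℂ} {ψ : 𝔼 → ℝ}
    (hψ : ContDiff ℝ ∞ ψ) (hψc : HasCompactSupport ψ) (hψT : tsupport ψ ⊆ T)
    (hu : MemLp u 2 (volume.restrict (tsupport ψ)))
    (hD : MemLp D 2 (volume.restrict (tsupport ψ)))
    (hparts : ∀ φ : 𝔼 → ℝ, ContDiff ℝ ∞ φ → HasCompactSupport φ → tsupport φ ⊆ T → ∀ w : 𝔼,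
      ∫ y in T, ((fderiv ℝ φ y w : ℝ) : ℂ) * u y = -∫ y in T, ((φ y : ℝ) : ℂ) * D y w)
    (hw : LocallyIntegrable (fun y => (ψ y : ℂ) * u y) volume)
    (hG : LocallyIntegrable (fun y => (ψ y : ℂ) • D y + u y • ofRealCov (fderiv ℝ ψ y)) volume)
    (φ : ContDiffBump (0 : 𝔼)) :
    fderiv ℝ (mollify φ fun y => (ψ y : ℂ) * u y)
      = mollify φ fun y => (ψ y : ℂ) • D y + u y • ofRealCov (fderiv ℝ ψ y) := by
  have hK : IsCompact (tsupport ψ) := hψc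
  have hui := integrableOn_of_memLp hK hu
  have hDi := integrableOn_of_memLp hK hD
  set k := φ.normed (volume : Measure 𝔼)
  have hk : ContDiff ℝ ∞ k := φ.contDiff_normed
  ext x z
  have hGint : Integrable (fun t => k (x - t) •
      ((ψ t : ℂ) • D t + u t • ofRealCov (fderiv ℝ ψ t))) volume :=
    convolutionExistsAt_iff_integrable_swap.1
      ((φ.hasCompactSupport_normed (μ := volume)).convolutionExists_left
        (ContinuousLinearMap.lsmul ℝ ℝ) φ.continuous_normed hG x)
  rw [fderiv_mollify_apply φ hw, mollify_apply, ContinuousLinearMap.integral_apply hGint]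
  -- The test function is the translated kernel times the cut-off. Its derivative contains `-(∂k)(x
  -- - t) ψ(t)`, so integration by parts trades the derivative of the kernel for `D` and the
  -- derivative of `ψ`.
  set η : 𝔼 → ℝ := fun t => k (x - t) * ψ t
  have hηd : ContDiff ℝ ∞ η := (hk.comp (contDiff_const.sub contDiff_id)).mul hψ
  have hηs : tsupport η ⊆ tsupport ψ :=
    closure_mono fun t ht => right_ne_zero_of_mul ht
  have hη0 : ∀ t ∉ tsupport ψ, η t = 0 := fun t ht => by
    simp [η, image_eq_zero_of_notMem_tsupport ht]
  have hηc : HasCompactSupport η := HasCompactSupport.intro hK hη0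
  have hηf : ∀ t, fderiv ℝ η t z = -(fderiv ℝ k (x - t) z * ψ t) + k (x - t) * fderiv ℝ ψ t z := by
    intro t
    have h1 : HasFDerivAt (fun t => k (x - t)) ((fderiv ℝ k (x - t)).comp
        (-ContinuousLinearMap.id ℝ 𝔼)) t :=
      ((hk.differentiable (by norm_num)) (x - t)).hasFDerivAt.comp t
        ((hasFDerivAt_id t).const_sub x)
    have h2 : HasFDerivAt η _ t := h1.mul ((hψ.differentiable (by norm_num)) t).hasFDerivAt
    rw [h2.fderiv]
    simp
    ring
  have hψ'0 : ∀ t ∉ tsupport ψ, fderiv ℝ ψ t = 0 := fun t ht =>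
    image_eq_zero_of_notMem_tsupport fun h => ht (tsupport_fderiv_subset ℝ h)
  have hη'0 : ∀ t ∉ tsupport ψ, fderiv ℝ η t z = 0 := fun t ht => by
    simp [hηf, hψ'0 t ht, image_eq_zero_of_notMem_tsupport ht]
  have hb := hparts η hηd hηc (hηs.trans hψT) z
  -- Since `η` is supported in `T`, both integrals over `T` are integrals over the whole space.
  rw [setIntegral_eq_integral_of_forall_compl_eq_zero (fun t ht => by
      simp [hη'0 t fun h => ht (hψT h)]),
    setIntegral_eq_integral_of_forall_compl_eq_zero (fun t ht => by
      simp [hη0 t fun h => ht (hψT h)])] at hb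
  have hψ'c : Continuous fun t => fderiv ℝ ψ t z :=
    (hψ.continuous_fderiv (by norm_num)).clm_apply continuous_const
  have hkc : Continuous fun t => k (x - t) := hk.continuous.comp (continuous_const.sub continuous_id)
  have i1 : Integrable (fun t => ((fderiv ℝ η t z : ℝ) : ℂ) * u t) volume := by
    simpa [Complex.real_smul] using integrable_smul_of_support hK hui
      ((hηd.continuous_fderiv (by norm_num)).clm_apply continuous_const) hη'0
  have i2 : Integrable (fun t => ((k (x - t) * fderiv ℝ ψ t z : ℝ) : ℂ) * u t) volume := by
    simpa [Complex.real_smul] using integrable_smul_of_support hK hui (hkc.mul hψ'c)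
      (fun t ht => by simp [hψ'0 t ht])
  have i3 : Integrable (fun t => ((η t : ℝ) : ℂ) * D t z) volume := by
    have := (integrable_smul_of_support hK hDi hηd.continuous hη0).apply_continuousLinearMap z
    simpa [Complex.real_smul] using this
  calc ∫ t, fderiv ℝ k (x - t) z • ((ψ t : ℂ) * u t)
      = ∫ t, (((k (x - t) * fderiv ℝ ψ t z : ℝ) : ℂ) * u t
          - ((fderiv ℝ η t z : ℝ) : ℂ) * u t) := by
        refine integral_congr_ae (ae_of_all _ fun t => ?_)
        simp only [hηf, Complex.real_smul]
        push_cast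
        ring
    _ = ∫ t, (((k (x - t) * fderiv ℝ ψ t z : ℝ) : ℂ) * u t + ((η t : ℝ) : ℂ) * D t z) := by
        rw [integral_sub i2 i1, integral_add i2 i3, hb, sub_neg_eq_add]
    _ = _ := by
        refine integral_congr_ae (ae_of_all _ fun t => ?_)
        simp only [η, ofRealCov, _root_.smul_apply, _root_.add_apply,
          ContinuousLinearMap.comp_apply, Complex.ofRealCLM_apply, Complex.real_smul, smul_eq_mul]
        push_cast
        ring

end Euclidean

/-! ### Inserting `ρ u` into the equation, for `ρ` supported in one chart. -/

section EigenIdentity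

variable {d : ℕ} {Ω : Type*} [TopologicalSpace Ω] [ChartedSpace (EuclideanSpace ℝ (Fin d)) Ω]
  [MeasurableSpace Ω] [BorelSpace Ω] {μ : Measure Ω}

local notation "𝔼" => EuclideanSpace ℝ (Fin d)

/-- Local finiteness is local integrability of the constant 1, which can be checked in charts. -/
theorem HasPositiveDensity.isLocallyFiniteMeasure (hμ : HasPositiveDensity d μ) :
    IsLocallyFiniteMeasure μ := by
  have h : LocallyIntegrable (fun _ : Ω => (1 : ℝ)) μ :=
    hμ.locallyIntegrable_of_charts fun e _ K _ hK =>
      integrableOn_const (hs := hK.measure_lt_top.ne)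
  refine ⟨fun x => ?_⟩
  obtain ⟨s, hs, hi⟩ := h x
  refine ⟨s, hs, ?_⟩
  simpa [integrableOn_const_iff] using hi

theorem HasLocalWeakDifferential.aestronglyMeasurable [SecondCountableTopology Ω]
    (hμ : HasPositiveDensity d μ)
    {u : Ω → ℂ} {Du : CovectorField d Ω} (hu : HasLocalWeakDifferential u Du) :
    AEStronglyMeasurable u μ :=
  (hμ.locallyIntegrable_of_charts fun e he K hKt hK =>
    integrableOn_of_memLp hK (hu.memLp e he K hKt hK)).aestronglyMeasurable

omit [ChartedSpace 𝔼 Ω] [TopologicalSpace Ω] [BorelSpace Ω] in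
theorem ae_abs_le_supNorm {W : Ω → ℝ} (hW : MemLp W ⊤ μ) : ∀ᵐ x ∂μ, |W x| ≤ supNorm μ W := by
  filter_upwards [ae_le_eLpNormEssSup (f := W) (μ := μ)] with x hx
  have h := hW.2.ne
  rw [← eLpNorm_exponent_top] at hx
  rw [← Real.norm_eq_abs, supNorm, ← toReal_enorm]
  exact ENNReal.toReal_mono h hx

omit [ChartedSpace 𝔼 Ω] [TopologicalSpace Ω] [BorelSpace Ω] in
theorem integrable_mul_mul_conj {u h : Ω → ℂ} (hu : AEStronglyMeasurable u μ)
    (hu1 : ∀ᵐ x ∂μ, ‖u x‖ ≤ 1) {W : Ω → ℝ} (hWm : AEStronglyMeasurable W μ) {M : ℝ}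
    (hW : ∀ᵐ x ∂μ, |W x| ≤ M) (hh : Integrable h μ) :
    Integrable (fun x => ((W x : ℝ) : ℂ) * u x * (starRingEnd ℂ) (h x)) μ := by
  have hh' : Integrable (fun x => (starRingEnd ℂ) (h x)) μ :=
    Complex.conjCLE.toContinuousLinearMap.integrable_comp hh
  refine hh'.bdd_mul (c := M) ((Complex.continuous_ofReal.comp_aestronglyMeasurable hWm).mul hu) ?_
  filter_upwards [hu1, hW] with x h1 h2
  rw [norm_mul, Complex.norm_real, Real.norm_eq_abs]
  calc |W x| * ‖u x‖ ≤ |W x| * 1 := by gcongr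
    _ ≤ M := by simpa using h2

variable [IsManifold (𝓡 d) ∞ Ω]

theorem IsLocallyElliptic.integrable_sesq {A : CoefficientField d Ω} (hA : IsLocallyElliptic A)
    (hμ : HasPositiveDensity d μ) {F G : CovectorField d Ω} (hF : F.IsLocallyL2)
    (hG : G.IsLocallyL2) {K : Set Ω} (hK : IsCompact K) (h0 : ∀ x ∉ K, G x = 0) :
    Integrable (fun x => sesq (A x) (F x) (G x)) μ := by
  rw [← integrableOn_iff_integrable_of_support_subset (s := K)]
  · exact (hA.locallyIntegrable_sesq hμ hF hG).integrableOn_isCompact hK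
  · intro x hx
    by_contra h
    exact hx (by simp only [h0 x h]; exact sesq_zero_right _ _)

/-- The quadratic expression which vanishes when `ρ * u` can be inserted as a test function in the
equation `(L + W) u = lam u`. -/
noncomputable def eigenDefect (A : CoefficientField d Ω) (μ : Measure Ω) (W : Ω → ℝ) (lam : ℝ)
    (u : Ω → ℂ) (Du : CovectorField d Ω) (ρ : Ω → ℝ) : ℂ :=
  (∫ x, sesq (A x) (Du x) (productDifferential u Du ρ x) ∂μ)
    + ∫ x, ((W x - lam : ℝ) : ℂ) * u x * (starRingEnd ℂ) ((ρ x : ℂ) * u x) ∂μ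

omit [MeasurableSpace Ω] [BorelSpace Ω] [IsManifold (𝓡 d) ∞ Ω] in
theorem differential_eq_zero {v : Ω → ℂ} {x : Ω} (hx : x ∉ tsupport v) : differential d v x = 0 :=
  mfderiv_eq_zero_of_notMem_tsupport hx

variable [T2Space Ω] [SecondCountableTopology Ω] {A : CoefficientField d Ω} {W : Ω → ℝ} {lam : ℝ}
  {u : Ω → ℂ} {Du : CovectorField d Ω}

omit [IsManifold (𝓡 d) ∞ Ω] [T2Space Ω] [SecondCountableTopology Ω] in
theorem integrable_ofReal_mul (hμ : HasPositiveDensity d μ) (hu : AEStronglyMeasurable u μ)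
    (hu1 : ∀ᵐ x ∂μ, ‖u x‖ ≤ 1) {ρ : Ω → ℝ} (hρ : Continuous ρ) (hρc : HasCompactSupport ρ) :
    Integrable (fun x => (ρ x : ℂ) * u x) μ := by
  have := hμ.isLocallyFiniteMeasure
  exact (hρ.integrable_of_hasCompactSupport hρc).ofReal.mul_bdd hu hu1

omit [IsManifold (𝓡 d) ∞ Ω] [T2Space Ω] in
-- The eigenvalue is absorbed into the potential. Boundedness of `u` and `W` makes the two zero
-- order integrals converge separately, so they may be combined.
theorem IsGeneralizedEigenfunction.eq_zero_of_test (hμ : HasPositiveDensity d μ)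
    (hW : MemLp W ⊤ μ) (hu : IsGeneralizedEigenfunction A μ W lam u Du)
    (hu1 : ∀ᵐ x ∂μ, ‖u x‖ ≤ 1) {v : Ω → ℂ} (hv : v ∈ testFunctions d Ω) :
    (∫ x, sesq (A x) (Du x) (differential d v x) ∂μ)
      + ∫ x, ((W x - lam : ℝ) : ℂ) * u x * (starRingEnd ℂ) (v x) ∂μ = 0 := by
  have := hμ.isLocallyFiniteMeasure
  have hum := hu.weak.aestronglyMeasurable hμ
  have hvi : Integrable v μ := hv.1.continuous.integrable_of_hasCompactSupport hv.2
  have i1 := integrable_mul_mul_conj hum hu1 hW.1 (ae_abs_le_supNorm hW) hvi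
  have i2 := integrable_mul_mul_conj hum hu1 (W := fun _ => lam) (M := |lam|)
    aestronglyMeasurable_const (ae_of_all _ fun _ => le_rfl) hvi
  have h := hu.equation v hv
  rw [form, ← integral_const_mul] at h
  have e : (∫ x, ((W x - lam : ℝ) : ℂ) * u x * (starRingEnd ℂ) (v x) ∂μ)
      = (∫ x, ((W x : ℝ) : ℂ) * u x * (starRingEnd ℂ) (v x) ∂μ)
        - ∫ x, (lam : ℂ) * (u x * (starRingEnd ℂ) (v x)) ∂μ := by
    simp only [← mul_assoc]
    rw [← integral_sub i1 i2]
    refine integral_congr_ae (ae_of_all _ fun x => ?_)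
    simp only
    push_cast
    ring
  rw [e, ← h]
  ring

/-- In a chart, `ρ * u` can be inserted as a test function in the equation. -/
theorem eigenDefect_eq_zero_of_chart (hμ : HasPositiveDensity d μ) (hA : IsLocallyElliptic A)
    (hW : MemLp W ⊤ μ) (hu : IsGeneralizedEigenfunction A μ W lam u Du)
    (hu1 : ∀ᵐ x ∂μ, ‖u x‖ ≤ 1) {e : OpenPartialHomeomorph Ω 𝔼} (he : e ∈ atlas 𝔼 Ω) {ρ : Ω → ℝ}
    (hρ : ContMDiff (𝓡 d) 𝓘(ℝ, ℝ) ∞ ρ) (hρc : HasCompactSupport ρ)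
    (hρs : tsupport ρ ⊆ e.source) : eigenDefect A μ W lam u Du ρ = 0 := by
  have := hμ.isLocallyFiniteMeasure
  have hum := hu.weak.aestronglyMeasurable hμ
  obtain ⟨ψ, hψ, hψc, hψt, hψρ, hρ0⟩ := contDiff_indicator_symm he hρ hρc hρs
  set K₀ := tsupport ψ
  have hK₀ : IsCompact K₀ := hψc
  -- Room for mollification: with kernels of radius at most `δ`, all mollifications vanish off one
  -- compact set `K` inside the chart.
  obtain ⟨δ, hδ, hδt⟩ := hK₀.exists_cthickening_subset_open e.open_target hψt
  set K := Metric.cthickening δ K₀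
  have hK : IsCompact K := hK₀.cthickening
  have hK₀K : K₀ ⊆ K := Metric.self_subset_cthickening _
  set u' : 𝔼 → ℂ := fun y => u (e.symm y)
  set D : 𝔼 → 𝔼 →L[ℝ] ℂ := fun y => Du.inChart e y
  set w : 𝔼 → ℂ := fun y => (ψ y : ℂ) * u' y
  set G : 𝔼 → 𝔼 →L[ℝ] ℂ := fun y => (ψ y : ℂ) • D y + u' y • ofRealCov (fderiv ℝ ψ y)
  have hu' : ∀ K ⊆ e.target, IsCompact K → MemLp u' 2 (volume.restrict K) :=
    hu.weak.memLp e he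
  have hD : ∀ K ⊆ e.target, IsCompact K → MemLp D 2 (volume.restrict K) :=
    hu.weak.memLp_differential e he
  have hψ0 : ∀ y ∉ K₀, ψ y = 0 := fun y hy => image_eq_zero_of_notMem_tsupport hy
  have hψ'0 : ∀ y ∉ K₀, fderiv ℝ ψ y = 0 := fun y hy =>
    image_eq_zero_of_notMem_tsupport fun h => hy (tsupport_fderiv_subset ℝ h)
  have hw0 : ∀ y ∉ K₀, w y = 0 := fun y hy => by simp [w, hψ0 y hy]
  have hG0 : ∀ y ∉ K₀, G y = 0 := fun y hy => by
    simp only [G, hψ0 y hy, hψ'0 y hy]; ext z; simp [ofRealCov]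
  have hwL : MemLp w 2 volume := by
    refine memLp_of_support hK₀ ?_ hw0
    have h1 : MemLp (fun y => (ψ y : ℂ)) ⊤ (volume.restrict K₀) :=
      memLp_of_continuousOn hK₀ (Complex.continuous_ofReal.comp hψ.continuous).continuousOn ⊤
    exact MemLp.smul (r := 2) (hu' K₀ hψt hK₀) h1
  have hGL : MemLp G 2 volume :=
    memLp_of_support hK₀ (memLp_smul_add_smul hK₀ (hu' K₀ hψt hK₀) (hD K₀ hψt hK₀)
      hψ.continuous.continuousOn (hψ.continuous_fderiv (by norm_num)).continuousOn) hG0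
  have hwi := hwL.locallyIntegrable (by norm_num)
  have hGi := hGL.locallyIntegrable (by norm_num)
  let φ : ℕ → ContDiffBump (0 : 𝔼) := fun n =>
    ⟨δ / (n + 1) / 2, δ / (n + 1), by positivity, half_lt_self (by positivity)⟩
  have hφδ : ∀ n, (φ n).rOut ≤ δ := fun n => div_le_self hδ.le (by norm_cast; omega)
  have hφ0 : Tendsto (fun n => (φ n).rOut) atTop (𝓝 0) := by
    have := (tendsto_one_div_add_atTop_nhds_zero_nat (𝕜 := ℝ)).const_mul δ
    simpa [φ, div_eq_mul_inv] using this
  have hfd : ∀ n, fderiv ℝ (mollify (φ n) w) = mollify (φ n) G := fun n =>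
    fderiv_mollify_mul hψ hψc hψt (hu' K₀ hψt hK₀) (hD K₀ hψt hK₀)
      (hu.weak.integral_by_parts e he) hwi hGi (φ n)
  have hwn0 : ∀ n, ∀ y ∉ K, mollify (φ n) w y = 0 := by
    intro n y hy
    refine mollify_eq_zero fun h => hy ?_
    refine Metric.cthickening_subset_of_subset _ ?_ (Metric.cthickening_mono (hφδ n) _ h)
    exact closure_minimal (fun z hz => by_contra fun h2 => hz (hw0 z h2)) hK₀.isClosed
  have hwnd : ∀ n, ContDiff ℝ ∞ (mollify (φ n) w) := fun n => contDiff_mollify _ hwi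
  set S := e.source ∩ e ⁻¹' K
  have hS : IsCompact S := isCompact_chart_preimage hδt hK
  set v : ℕ → Ω → ℂ := fun n => chartExtend e (mollify (φ n) w)
  have hv : ∀ n, v n ∈ testFunctions d Ω := fun n =>
    ⟨contMDiff_chartExtend he (hwnd n) hδt hK (hwn0 n),
      hasCompactSupport_chartExtend hδt hK (hwn0 n)⟩
  have hvS : ∀ n, ∀ x ∉ S, x ∉ tsupport (v n) := fun n x hx h =>
    hx (tsupport_chartExtend_subset hδt hK (hwn0 n) h)
  have hρS : ∀ x ∉ S, x ∉ tsupport ρ := by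
    intro x hx h
    refine hx (closure_minimal (t := S) (fun z hz => ?_) hS.isClosed h)
    by_contra hzS
    exact hz (hρ0 z fun hz' => hzS ⟨hz'.1, hK₀K hz'.2⟩)
  have hGn : ∀ n, AEStronglyMeasurable (mollify (φ n) G - G) (volume.restrict K) := fun n =>
    ((contDiff_mollify _ hGi).continuous.aestronglyMeasurable.sub hGL.1).mono_measure
      Measure.restrict_le_self
  have hwn : ∀ n, AEStronglyMeasurable (mollify (φ n) w - w) (volume.restrict K) := fun n =>
    ((hwnd n).continuous.aestronglyMeasurable.sub hwL.1).mono_measure Measure.restrict_le_self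
  -- the gradient term
  obtain ⟨c, -, hc⟩ := hA.exists_norm_sesq_le he hδt hK
  have hvin : ∀ n, ∀ y ∈ e.target, (differential d (v n)).inChart e y = mollify (φ n) G y := by
    intro n y hy
    rw [differential_inChart he (hv n).1 hy, ← hfd n]
    refine Filter.EventuallyEq.fderiv_eq ?_
    filter_upwards [e.open_target.mem_nhds hy] with z hz
    exact chartExtend_symm e _ hz
  have hPin : ∀ y ∈ e.target, (productDifferential u Du ρ).inChart e y = G y := by
    intro y hy
    have h1 : fderiv ℝ (fun y => ρ (e.symm y)) y = fderiv ℝ ψ y := by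
      refine Filter.EventuallyEq.fderiv_eq ?_
      filter_upwards [e.open_target.mem_nhds hy] with z hz using (hψρ z hz).symm
    rw [productDifferential_inChart u Du hρ he hy, h1, ← hψρ y hy]
  have t1 : Tendsto (fun n => ∫ x, (sesq (A x) (Du x) (differential d (v n) x)
      - sesq (A x) (Du x) (productDifferential u Du ρ x)) ∂μ) atTop (𝓝 0) := by
    refine hμ.tendsto_integral_zero he hδt hK (hD K hδt hK) hGn
      (tendsto_eLpNorm_mollify_sub hφ0 hGL) c ?_ ?_
    · intro n x hx
      rw [differential_eq_zero (hvS n x hx), productDifferential_eq_zero (hρS x hx), sub_self]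
    · intro n
      filter_upwards [ae_restrict_mem (measurableSet_chart_preimage e hK)] with x hx
      have h1 := sesq_symm_eq A Du (differential d (v n)) he (hδt hx.2)
      have h2 := sesq_symm_eq A Du (productDifferential u Du ρ) he (hδt hx.2)
      rw [hvin n _ (hδt hx.2)] at h1
      rw [hPin _ (hδt hx.2)] at h2
      have h3 := hc (e x) hx.2 (D (e x)) ((mollify (φ n) G - G) (e x))
      rw [Pi.sub_apply, sesq_sub_right, ← h1, ← h2, e.left_inv hx.1] at h3
      exact h3
  -- the zero order term
  have hM : ∀ᵐ x ∂μ, |W x - lam| ≤ supNorm μ W + |lam| := by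
    filter_upwards [ae_abs_le_supNorm hW] with x hx
    exact (abs_sub _ _).trans (by gcongr)
  have t2 : Tendsto (fun n => ∫ x, (((W x - lam : ℝ) : ℂ) * u x * (starRingEnd ℂ) (v n x)
      - ((W x - lam : ℝ) : ℂ) * u x * (starRingEnd ℂ) ((ρ x : ℂ) * u x)) ∂μ) atTop (𝓝 0) := by
    -- Pairing with the constant 1, which is in `L²(K)`, turns `L²` convergence into `L¹`
    -- convergence; the coefficient `(W - lam) u` is bounded.
    refine hμ.tendsto_integral_zero he hδt hK (h := fun _ => (1 : ℝ))
      (memLp_of_continuousOn hK continuousOn_const 2) hwn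
      (tendsto_eLpNorm_mollify_sub hφ0 hwL) (supNorm μ W + |lam|) ?_ ?_
    · intro n x hx
      rw [image_eq_zero_of_notMem_tsupport (hvS n x hx),
        image_eq_zero_of_notMem_tsupport (hρS x hx)]
      simp
    · intro n
      filter_upwards [ae_restrict_mem (measurableSet_chart_preimage e hK),
        ae_restrict_of_ae hM, ae_restrict_of_ae hu1] with x hx h1 h2
      have e1 : v n x - (ρ x : ℂ) * u x = (mollify (φ n) w - w) (e x) := by
        have h3 := chartExtend_symm e (mollify (φ n) w) (hδt hx.2)
        have h4 := hψρ (e x) (hδt hx.2)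
        rw [e.left_inv hx.1] at h3 h4
        simp only [v, w, u', Pi.sub_apply, h3, h4, e.left_inv hx.1]
      rw [← mul_sub, ← map_sub, e1, norm_mul, norm_mul, Complex.norm_real, Real.norm_eq_abs,
        RCLike.norm_conj, norm_one, one_mul]
      have h5 : |W x - lam| * ‖u x‖ ≤ supNorm μ W + |lam| :=
        (mul_le_of_le_one_right (abs_nonneg _) h2).trans h1
      gcongr
  have hsum := t1.add t2
  have hDu : Du.IsLocallyL2 := hu.weak.memLp_differential
  have hP := hA.integrable_sesq hμ hDu (isLocallyL2_productDifferential hu.weak hρ) hρc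
    (fun x hx => productDifferential_eq_zero hx)
  have hWm : AEStronglyMeasurable (fun x => W x - lam) μ := hW.1.sub aestronglyMeasurable_const
  have hP2 := integrable_mul_mul_conj hum hu1 hWm hM
    (integrable_ofReal_mul hμ hum hu1 hρ.continuous hρc)
  -- Each `v n` satisfies the equation exactly, so this sum does not depend on `n`; as it tends to
  -- zero, the defect vanishes.
  have hconst : ∀ n, (∫ x, (sesq (A x) (Du x) (differential d (v n) x)
      - sesq (A x) (Du x) (productDifferential u Du ρ x)) ∂μ)
      + (∫ x, (((W x - lam : ℝ) : ℂ) * u x * (starRingEnd ℂ) (v n x)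
      - ((W x - lam : ℝ) : ℂ) * u x * (starRingEnd ℂ) ((ρ x : ℂ) * u x)) ∂μ)
      = -eigenDefect A μ W lam u Du ρ := by
    intro n
    have hvi : Integrable (v n) μ := (hv n).1.continuous.integrable_of_hasCompactSupport (hv n).2
    have h1 := hA.integrable_sesq hμ hDu (isLocallyL2_differential (hv n).1) (hv n).2
      (fun x hx => differential_eq_zero hx)
    have h2 := integrable_mul_mul_conj hum hu1 hWm hM hvi
    rw [integral_sub h1 hP, integral_sub h2 hP2, eigenDefect]
    linear_combination hu.eq_zero_of_test hμ hW hu1 (hv n)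
  simp only [hconst, add_zero] at hsum
  exact neg_eq_zero.1 (tendsto_nhds_unique tendsto_const_nhds hsum)

end EigenIdentity

/-! ### From one chart to all of `Ω` by a partition of unity. -/

section GlobalIdentity

variable {d : ℕ} {Ω : Type*} [TopologicalSpace Ω] [ChartedSpace (EuclideanSpace ℝ (Fin d)) Ω]
  [MeasurableSpace Ω] [BorelSpace Ω] {μ : Measure Ω}
  [IsManifold (𝓡 d) ∞ Ω] [T2Space Ω] [SecondCountableTopology Ω]
  {A : CoefficientField d Ω} {W : Ω → ℝ} {lam : ℝ} {u : Ω → ℂ} {Du : CovectorField d Ω}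

local notation "𝔼" => EuclideanSpace ℝ (Fin d)

omit [MeasurableSpace Ω] [BorelSpace Ω] [IsManifold (𝓡 d) ∞ Ω] [T2Space Ω]
  [SecondCountableTopology Ω] in
theorem productDifferential_add {ρ σ : Ω → ℝ} (hρ : ContMDiff (𝓡 d) 𝓘(ℝ, ℝ) ∞ ρ)
    (hσ : ContMDiff (𝓡 d) 𝓘(ℝ, ℝ) ∞ σ) (x : Ω) :
    productDifferential u Du (ρ + σ) x
      = productDifferential u Du ρ x + productDifferential u Du σ x := by
  have h : realDifferential (d := d) (ρ + σ) x
      = realDifferential (d := d) ρ x + realDifferential (d := d) σ x :=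
    mfderiv_add (hρ.mdifferentiable (by norm_num) x) (hσ.mdifferentiable (by norm_num) x)
  ext w
  simp [productDifferential, h, ofRealCov]
  ring

omit [T2Space Ω] in
theorem eigenDefect_add (hμ : HasPositiveDensity d μ) (hA : IsLocallyElliptic A)
    (hW : MemLp W ⊤ μ) (hu : IsGeneralizedEigenfunction A μ W lam u Du)
    (hu1 : ∀ᵐ x ∂μ, ‖u x‖ ≤ 1) {ρ σ : Ω → ℝ} (hρ : ContMDiff (𝓡 d) 𝓘(ℝ, ℝ) ∞ ρ)
    (hρc : HasCompactSupport ρ) (hσ : ContMDiff (𝓡 d) 𝓘(ℝ, ℝ) ∞ σ) (hσc : HasCompactSupport σ) :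
    eigenDefect A μ W lam u Du (ρ + σ)
      = eigenDefect A μ W lam u Du ρ + eigenDefect A μ W lam u Du σ := by
  have hum := hu.weak.aestronglyMeasurable hμ
  have hM : ∀ᵐ x ∂μ, |W x - lam| ≤ supNorm μ W + |lam| := by
    filter_upwards [ae_abs_le_supNorm hW] with x hx
    exact (abs_sub _ _).trans (by gcongr)
  have hWm : AEStronglyMeasurable (fun x => W x - lam) μ := hW.1.sub aestronglyMeasurable_const
  have i1 : ∀ {ρ : Ω → ℝ}, ContMDiff (𝓡 d) 𝓘(ℝ, ℝ) ∞ ρ → HasCompactSupport ρ →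
      Integrable (fun x => sesq (A x) (Du x) (productDifferential u Du ρ x)) μ := fun hρ hρc =>
    hA.integrable_sesq hμ hu.weak.memLp_differential (isLocallyL2_productDifferential hu.weak hρ)
      hρc (fun x hx => productDifferential_eq_zero hx)
  have i2 : ∀ {ρ : Ω → ℝ}, ContMDiff (𝓡 d) 𝓘(ℝ, ℝ) ∞ ρ → HasCompactSupport ρ →
      Integrable (fun x => ((W x - lam : ℝ) : ℂ) * u x * (starRingEnd ℂ) ((ρ x : ℂ) * u x)) μ :=
    fun hρ hρc => integrable_mul_mul_conj hum hu1 hWm hM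
      (integrable_ofReal_mul hμ hum hu1 hρ.continuous hρc)
  simp only [eigenDefect, productDifferential_add hρ hσ, sesq_add_right, Pi.add_apply,
    Complex.ofReal_add, add_mul, map_add, mul_add]
  rw [integral_add (i1 hρ hρc) (i1 hσ hσc), integral_add (i2 hρ hρc) (i2 hσ hσc)]
  ring

/-- For every smooth compactly supported real `ρ`, the function `ρ * u` can be inserted as a test
function in the equation for a bounded generalized eigenfunction `u`. -/
theorem eigenDefect_eq_zero (hμ : HasPositiveDensity d μ) (hA : IsLocallyElliptic A)
    (hW : MemLp W ⊤ μ) (hu : IsGeneralizedEigenfunction A μ W lam u Du)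
    (hu1 : ∀ᵐ x ∂μ, ‖u x‖ ≤ 1) {ρ : Ω → ℝ}
    (hρ : ContMDiff (𝓡 d) 𝓘(ℝ, ℝ) ∞ ρ) (hρc : HasCompactSupport ρ) :
    eigenDefect A μ W lam u Du ρ = 0 := by
  have : LocallyCompactSpace Ω := ChartedSpace.locallyCompactSpace 𝔼 Ω
  obtain ⟨f, hf⟩ := SmoothPartitionOfUnity.exists_isSubordinate_chartAt_source (𝓡 d) Ω
  have hfin := f.locallyFinite.finite_nonempty_inter_compact (s := tsupport ρ) hρc
  have hsum : ρ = ∑ i ∈ hfin.toFinset, fun x => f i x * ρ x := by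
    funext x
    rw [Finset.sum_apply, ← Finset.sum_mul]
    by_cases hx : x ∈ tsupport ρ
    · have h1 := f.sum_eq_one (mem_univ x)
      rw [finsum_eq_sum_of_support_subset (s := hfin.toFinset)] at h1
      · rw [h1, one_mul]
      · intro i hi
        simp only [Finite.coe_toFinset, mem_ofPred_eq]
        exact ⟨x, hi, hx⟩
    · rw [image_eq_zero_of_notMem_tsupport hx, mul_zero]
  -- The induction carries smoothness and compact support along, because `eigenDefect_add` needs
  -- them to split its integrals.
  let P : (Ω → ℝ) → Prop := fun ρ => ContMDiff (𝓡 d) 𝓘(ℝ, ℝ) ∞ ρ ∧ HasCompactSupport ρ ∧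
    eigenDefect A μ W lam u Du ρ = 0
  have hP : P (∑ i ∈ hfin.toFinset, fun x => f i x * ρ x) := by
    refine Finset.sum_induction _ P ?_ ?_ ?_
    · rintro ρ σ ⟨h1, h2, h3⟩ ⟨h4, h5, h6⟩
      refine ⟨h1.add h4, h2.add h5, ?_⟩
      rw [eigenDefect_add hμ hA hW hu hu1 h1 h2 h4 h5, h3, h6, add_zero]
    · have hc : HasCompactSupport (0 : Ω → ℝ) := HasCompactSupport.zero
      refine ⟨contMDiff_const, hc, ?_⟩
      have h0 : ∀ x : Ω, x ∉ tsupport (0 : Ω → ℝ) := fun x => by simp [tsupport]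
      have h : ∀ x, sesq (A x) (Du x) (productDifferential u Du 0 x) = 0 := fun x => by
        rw [productDifferential_eq_zero (h0 x)]
        exact sesq_zero_right _ _
      simp [eigenDefect, h]
    · intro i _
      have h1 : ContMDiff (𝓡 d) 𝓘(ℝ, ℝ) ∞ fun x => f i x * ρ x := (f i).contMDiff.mul hρ
      have h2 : HasCompactSupport fun x => f i x * ρ x := hρc.mul_left
      refine ⟨h1, h2, eigenDefect_eq_zero_of_chart hμ hA hW hu hu1 (chart_mem_atlas 𝔼 i) h1 h2 ?_⟩
      exact (closure_mono fun x hx => left_ne_zero_of_mul hx).trans (hf i)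
  rw [← hsum] at hP
  exact hP.2.2

end GlobalIdentity

/-! ### The Caccioppoli type inequality for test functions. -/

section Energy

variable {d : ℕ} {Ω : Type*} [TopologicalSpace Ω] [ChartedSpace (EuclideanSpace ℝ (Fin d)) Ω]
  [IsManifold (𝓡 d) ∞ Ω]

omit [IsManifold (𝓡 d) ∞ Ω] in
-- Splitting `d|v|² = 2 Re (conj v dv)` into two real covectors lets Young's inequality act on each
-- one separately.
theorem realDifferential_norm_sq {v : Ω → ℂ} {x : Ω}
    (hv : MDifferentiableAt (𝓡 d) 𝓘(ℝ, ℂ) v x) :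
    realDifferential (d := d) (fun x => ‖v x‖ ^ 2) x
      = (2 * (v x).re) • covRe (differential d v x)
        + (2 * (v x).im) • covIm (differential d v x) := by
  have h1 : HasFDerivAt (fun z : ℂ => ‖z‖ ^ 2) (2 • innerSL ℝ (v x)) (v x) :=
    (hasStrictFDerivAt_norm_sq (v x)).hasFDerivAt
  have h2 := h1.hasMFDerivAt.comp x hv.hasMFDerivAt
  have h3 : realDifferential (d := d) (fun x => ‖v x‖ ^ 2) x
    = (2 • innerSL ℝ (v x)).comp (differential d v x) := h2.mfderiv
  rw [h3]
  ext w
  simp [covRe, covIm, Complex.inner]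
  ring

omit [IsManifold (𝓡 d) ∞ Ω] in
theorem contMDiff_norm_sq {v : Ω → ℂ} (hv : ContMDiff (𝓡 d) 𝓘(ℝ, ℂ) ∞ v) :
    ContMDiff (𝓡 d) 𝓘(ℝ, ℝ) ∞ fun x => ‖v x‖ ^ 2 :=
  (contDiff_norm_sq ℝ).contMDiff.comp hv

omit [ChartedSpace (EuclideanSpace ℝ (Fin d)) Ω] [IsManifold (𝓡 d) ∞ Ω] in
theorem hasCompactSupport_norm_sq {v : Ω → ℂ} (hv : HasCompactSupport v) :
    HasCompactSupport fun x => ‖v x‖ ^ 2 :=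
  hv.comp_left (g := fun z : ℂ => ‖z‖ ^ 2) (by simp)

/-- The pointwise estimate behind the Caccioppoli type inequality. -/
theorem energy_pointwise_le {A : CoefficientField d Ω} (hA : IsLocallyElliptic A) {u v : Ω → ℂ}
    {Du : CovectorField d Ω} {x : Ω} (hv : MDifferentiableAt (𝓡 d) 𝓘(ℝ, ℂ) v x)
    (hu : ‖u x‖ ≤ 1) {t : ℝ} (ht : 0 < t) :
    (1 - t) * (‖v x‖ ^ 2 * (sesq (A x) (Du x) (Du x)).re)
      ≤ (sesq (A x) (Du x) (productDifferential u Du (fun x => ‖v x‖ ^ 2) x)).re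
        + t⁻¹ * (sesq (A x) (differential d v x) (differential d v x)).re := by
  have hs := hA.symm x
  have hn := hA.nonneg x
  set p := covRe (differential d v x)
  set q := covIm (differential d v x)
  have e1 : productDifferential u Du (fun x => ‖v x‖ ^ 2) x
      = ((‖v x‖ ^ 2 : ℝ) : ℂ) • Du x
        + (((2 * (v x).re : ℝ) : ℂ) • (u x • ofRealCov p)
          + ((2 * (v x).im : ℝ) : ℂ) • (u x • ofRealCov q)) := by
    rw [productDifferential, realDifferential_norm_sq hv]
    congr 1
    ext w
    simp [ofRealCov, p, q]
    ring
  have e2 : (sesq (A x) (Du x) (productDifferential u Du (fun x => ‖v x‖ ^ 2) x)).re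
      = ‖v x‖ ^ 2 * (sesq (A x) (Du x) (Du x)).re
        + (2 * (v x).re * (sesq (A x) (Du x) (u x • ofRealCov p)).re
          + 2 * (v x).im * (sesq (A x) (Du x) (u x • ofRealCov q)).re) := by
    rw [e1, sesq_add_right, sesq_add_right, sesq_smul_right, sesq_smul_right _ _ _ (u x • _),
      sesq_smul_right _ (2 * (v x).im : ℝ)]
    simp only [Complex.conj_ofReal, Complex.add_re, Complex.re_ofReal_mul]
  -- One application with weight `Re v` and one with weight `Im v`: the squared weights add up to
  -- `|v|²`, and the remainders to `|u|² ⟨A∇v, ∇v⟩`.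
  have y1 := neg_two_mul_sesq_re_le hs hn (Du x) p (u x) (v x).re ht
  have y2 := neg_two_mul_sesq_re_le hs hn (Du x) q (u x) (v x).im ht
  have e3 : ‖v x‖ ^ 2 = (v x).re ^ 2 + (v x).im ^ 2 := by
    rw [← Complex.normSq_eq_norm_sq, Complex.normSq_apply]; ring
  have hu2 : ‖u x‖ ^ 2 ≤ 1 := pow_le_one₀ (norm_nonneg _) hu
  have z1 : t⁻¹ * (‖u x‖ ^ 2 * A x p p) ≤ t⁻¹ * A x p p := by
    have := mul_le_of_le_one_left (hn p) hu2
    gcongr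
  have z2 : t⁻¹ * (‖u x‖ ^ 2 * A x q q) ≤ t⁻¹ * A x q q := by
    have := mul_le_of_le_one_left (hn q) hu2
    gcongr
  rw [e2, sesq_self_re (A x) (differential d v x), e3]
  rw [mul_add t⁻¹]
  nlinarith [y1, y2, z1, z2]

variable [MeasurableSpace Ω] [BorelSpace Ω] {μ : Measure Ω}
  {A : CoefficientField d Ω} {W : Ω → ℝ}

omit [IsManifold (𝓡 d) ∞ Ω] in
theorem integrable_norm_sq (hμ : HasPositiveDensity d μ) {v : Ω → ℂ}
    (hv : v ∈ testFunctions d Ω) : Integrable (fun x => ‖v x‖ ^ 2) μ := by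
  have := hμ.isLocallyFiniteMeasure
  exact (contMDiff_norm_sq hv.1).continuous.integrable_of_hasCompactSupport
    (hasCompactSupport_norm_sq hv.2)

theorem integrable_sesq_differential (hμ : HasPositiveDensity d μ) (hA : IsLocallyElliptic A)
    {v : Ω → ℂ} (hv : v ∈ testFunctions d Ω) :
    Integrable (fun x => sesq (A x) (differential d v x) (differential d v x)) μ :=
  hA.integrable_sesq hμ (isLocallyL2_differential hv.1) (isLocallyL2_differential hv.1) hv.2
    fun _ hx => differential_eq_zero hx

omit [IsManifold (𝓡 d) ∞ Ω] in
theorem integrable_weight_mul_norm_sq (hμ : HasPositiveDensity d μ) (hW : MemLp W ⊤ μ)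
    {v : Ω → ℂ} (hv : v ∈ testFunctions d Ω) : Integrable (fun x => W x * ‖v x‖ ^ 2) μ :=
  (integrable_norm_sq hμ hv).bdd_mul hW.1 (ae_abs_le_supNorm hW)

/-- The weight `1 + ‖W‖_∞ + W` is nonnegative a.e., so the quantity under the square root in
`testNorm` is nonnegative and squaring recovers it. -/
theorem testNorm_sq (hμ : HasPositiveDensity d μ) (hA : IsLocallyElliptic A)
    (hW : MemLp W ⊤ μ) {v : Ω → ℂ} (hv : v ∈ testFunctions d Ω) :
    testNorm A μ W v ^ 2 = (∫ x, (sesq (A x) (differential d v x) (differential d v x)).re ∂μ)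
      + ∫ x, (1 + supNorm μ W + W x) * ‖v x‖ ^ 2 ∂μ := by
  have i1 := integrable_norm_sq hμ hv
  have i2 := integrable_weight_mul_norm_sq hμ hW hv
  have e0 : (∫ x, (1 + supNorm μ W + W x) * ‖v x‖ ^ 2 ∂μ)
      = (1 + supNorm μ W) * (∫ x, ‖v x‖ ^ 2 ∂μ) + ∫ x, W x * ‖v x‖ ^ 2 ∂μ := by
    rw [← integral_const_mul, ← integral_add (i1.const_mul _) i2]
    simp only [add_mul]
  have e1 : (form A μ W v (differential d v) v (differential d v)).re
      = (∫ x, (sesq (A x) (differential d v x) (differential d v x)).re ∂μ)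
        + ∫ x, W x * ‖v x‖ ^ 2 ∂μ := by
    rw [form, Complex.add_re]
    congr 1
    · exact (Complex.reCLM.integral_comp_comm (integrable_sesq_differential hμ hA hv)).symm
    · have : ∀ x, ((W x : ℝ) : ℂ) * v x * (starRingEnd ℂ) (v x) = ((W x * ‖v x‖ ^ 2 : ℝ) : ℂ) := by
        intro x
        rw [mul_assoc, Complex.mul_conj, Complex.normSq_eq_norm_sq]
        push_cast
        ring
      simp only [this]
      rw [integral_complex_ofReal, Complex.ofReal_re]
  have hpos : 0 ≤ (∫ x, (sesq (A x) (differential d v x) (differential d v x)).re ∂μ)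
      + ∫ x, (1 + supNorm μ W + W x) * ‖v x‖ ^ 2 ∂μ := by
    refine add_nonneg (integral_nonneg fun x => sesq_self_nonneg (hA.nonneg x) _)
      (integral_nonneg_of_ae ?_)
    filter_upwards [ae_abs_le_supNorm hW] with x hx
    have := (abs_le.1 hx).1
    exact mul_nonneg (by linarith) (by positivity)
  rw [testNorm, e1, add_assoc, add_comm (∫ x, W x * ‖v x‖ ^ 2 ∂μ), ← e0, Real.sq_sqrt hpos]

/-- The weight `1 + ‖W‖_∞ + W` is at least 1 a.e. -/
theorem integral_add_integral_le_testNorm_sq (hμ : HasPositiveDensity d μ)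
    (hA : IsLocallyElliptic A) (hW : MemLp W ⊤ μ) {v : Ω → ℂ} (hv : v ∈ testFunctions d Ω) :
    (∫ x, (sesq (A x) (differential d v x) (differential d v x)).re ∂μ) + ∫ x, ‖v x‖ ^ 2 ∂μ
      ≤ testNorm A μ W v ^ 2 := by
  rw [testNorm_sq hμ hA hW hv]
  gcongr 1
  refine integral_mono_ae (integrable_norm_sq hμ hv) ?_ ?_
  · simp only [add_mul _ (W _)]
    exact ((integrable_norm_sq hμ hv).const_mul _).add (integrable_weight_mul_norm_sq hμ hW hv)
  · filter_upwards [ae_abs_le_supNorm hW] with x hx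
    have := (abs_le.1 hx).1
    exact le_mul_of_one_le_left (by positivity) (by linarith)

omit [IsManifold (𝓡 d) ∞ Ω] [MeasurableSpace Ω] [BorelSpace Ω] in
theorem sub_mem_testFunctions {v w : Ω → ℂ} (hv : v ∈ testFunctions d Ω)
    (hw : w ∈ testFunctions d Ω) : v - w ∈ testFunctions d Ω :=
  ⟨hv.1.sub hw.1, hv.2.sub hw.2⟩

/-- A weak triangle inequality, obtained pointwise from the parallelogram law; it suffices to bound
the norms along a Cauchy sequence. -/
theorem testNorm_sq_le (hμ : HasPositiveDensity d μ) (hA : IsLocallyElliptic A)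
    (hW : MemLp W ⊤ μ) {v w : Ω → ℂ} (hv : v ∈ testFunctions d Ω) (hw : w ∈ testFunctions d Ω) :
    testNorm A μ W v ^ 2 ≤ 2 * testNorm A μ W (v - w) ^ 2 + 2 * testNorm A μ W w ^ 2 := by
  have hvw := sub_mem_testFunctions hv hw
  have i1 : ∀ {v : Ω → ℂ}, v ∈ testFunctions d Ω →
      Integrable (fun x => (sesq (A x) (differential d v x) (differential d v x)).re) μ :=
    fun hv => (integrable_sesq_differential hμ hA hv).re
  have i2 : ∀ {v : Ω → ℂ}, v ∈ testFunctions d Ω →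
      Integrable (fun x => (1 + supNorm μ W + W x) * ‖v x‖ ^ 2) μ := fun hv => by
    simp only [add_mul _ (W _)]
    exact ((integrable_norm_sq hμ hv).const_mul _).add (integrable_weight_mul_norm_sq hμ hW hv)
  have h1 : (∫ x, (sesq (A x) (differential d v x) (differential d v x)).re ∂μ)
      ≤ 2 * (∫ x, (sesq (A x) (differential d (v - w) x) (differential d (v - w) x)).re ∂μ)
        + 2 * ∫ x, (sesq (A x) (differential d w x) (differential d w x)).re ∂μ := by
    rw [← integral_const_mul, ← integral_const_mul,
      ← integral_add ((i1 hvw).const_mul 2) ((i1 hw).const_mul 2)]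
    refine integral_mono (i1 hv) (((i1 hvw).const_mul 2).add ((i1 hw).const_mul 2)) fun x => ?_
    have e : differential d v x = differential d (v - w) x + differential d w x := by
      have h : differential d (v - w) x = differential d v x - differential d w x :=
        mfderiv_sub (hv.1.mdifferentiable (by norm_num) x) (hw.1.mdifferentiable (by norm_num) x)
      rw [h, sub_add_cancel]
    have := sesq_add_self_le (hA.nonneg x) (differential d (v - w) x) (differential d w x)
    rw [← e] at this
    exact this
  have h2 : (∫ x, (1 + supNorm μ W + W x) * ‖v x‖ ^ 2 ∂μ)
      ≤ 2 * (∫ x, (1 + supNorm μ W + W x) * ‖(v - w) x‖ ^ 2 ∂μ)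
        + 2 * ∫ x, (1 + supNorm μ W + W x) * ‖w x‖ ^ 2 ∂μ := by
    rw [← integral_const_mul, ← integral_const_mul,
      ← integral_add ((i2 hvw).const_mul 2) ((i2 hw).const_mul 2)]
    refine integral_mono_ae (i2 hv) (((i2 hvw).const_mul 2).add ((i2 hw).const_mul 2)) ?_
    filter_upwards [ae_abs_le_supNorm hW] with x hx
    have hc : 0 ≤ 1 + supNorm μ W + W x := by linarith [(abs_le.1 hx).1]
    have h3 : ‖v x‖ ≤ ‖(v - w) x‖ + ‖w x‖ := by simpa using norm_add_le (v x - w x) (w x)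
    have h4 : ‖v x‖ ^ 2 ≤ 2 * ‖(v - w) x‖ ^ 2 + 2 * ‖w x‖ ^ 2 := by
      have := pow_le_pow_left₀ (norm_nonneg _) h3 2
      nlinarith [sq_nonneg (‖(v - w) x‖ - ‖w x‖)]
    calc _ ≤ (1 + supNorm μ W + W x) * (2 * ‖(v - w) x‖ ^ 2 + 2 * ‖w x‖ ^ 2) := by gcongr
      _ = _ := by ring
  rw [testNorm_sq hμ hA hW hv, testNorm_sq hμ hA hW hvw, testNorm_sq hμ hA hW hw]
  linarith

variable [T2Space Ω] [SecondCountableTopology Ω] {lam : ℝ} {u : Ω → ℂ} {Du : CovectorField d Ω}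

/-- The energy inequality for test functions. -/
theorem energy_le (hμ : HasPositiveDensity d μ) (hA : IsLocallyElliptic A)
    (hW : MemLp W ⊤ μ) (hu : IsGeneralizedEigenfunction A μ W lam u Du)
    (hu1 : ∀ᵐ x ∂μ, ‖u x‖ ≤ 1) {v : Ω → ℂ} (hv : v ∈ testFunctions d Ω) :
    Integrable (fun x => ‖v x‖ ^ 2 * (sesq (A x) (Du x) (Du x)).re) μ ∧
      ∫ x, ‖v x‖ ^ 2 * (sesq (A x) (Du x) (Du x)).re ∂μ
        ≤ (1 + √(1 + |lam| + supNorm μ W)) ^ 2 * testNorm A μ W v ^ 2 := by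
  have hDu : Du.IsLocallyL2 := hu.weak.memLp_differential
  have hum := hu.weak.aestronglyMeasurable hμ
  have hρ := contMDiff_norm_sq hv.1
  have hρc := hasCompactSupport_norm_sq hv.2
  have hE : Integrable (fun x => ‖v x‖ ^ 2 * (sesq (A x) (Du x) (Du x)).re) μ := by
    have := ((hA.locallyIntegrable_sesq hμ hDu hDu).integrable_smul_left_of_hasCompactSupport
      hρ.continuous hρc).re
    refine this.congr (ae_of_all _ fun x => ?_)
    exact Complex.smul_re _ _
  refine ⟨hE, ?_⟩
  set M := |lam| + supNorm μ W
  have hM0 : 0 ≤ M := add_nonneg (abs_nonneg _) ENNReal.toReal_nonneg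
  -- `s` is the larger root of `s² = 2 s + M`, the minimizer of `s (M + s) / (s - 1)` on `s > 1`.
  -- Young's inequality is used with `t = s⁻¹`.
  set s := 1 + √(1 + |lam| + supNorm μ W)
  have hs1 : 1 < s := by
    have : 0 < √(1 + |lam| + supNorm μ W) := Real.sqrt_pos.2 (by linarith)
    linarith
  have hs0 : 0 < s := by linarith
  have hs2 : s ^ 2 = 2 * s + M := by
    have := Real.sq_sqrt (show 0 ≤ 1 + |lam| + supNorm μ W by linarith)
    have e : √(1 + |lam| + supNorm μ W) = s - 1 := by simp [s]
    rw [e] at this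
    nlinarith
  have hM : ∀ᵐ x ∂μ, |W x - lam| ≤ M := by
    filter_upwards [ae_abs_le_supNorm hW] with x hx
    have := abs_sub (W x) lam
    linarith
  have hWm : AEStronglyMeasurable (fun x => W x - lam) μ := hW.1.sub aestronglyMeasurable_const
  have i1 := hA.integrable_sesq hμ hDu (isLocallyL2_productDifferential hu.weak hρ) hρc
    (fun x hx => productDifferential_eq_zero hx)
  have i2 := integrable_mul_mul_conj hum hu1 hWm hM
    (integrable_ofReal_mul hμ hum hu1 hρ.continuous hρc)
  have i1r : Integrable (fun x =>
      (sesq (A x) (Du x) (productDifferential u Du (fun x => ‖v x‖ ^ 2) x)).re) μ := i1.re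
  have i3 : Integrable (fun x => (sesq (A x) (differential d v x) (differential d v x)).re) μ :=
    (integrable_sesq_differential hμ hA hv).re
  have i4 := integrable_norm_sq hμ hv
  have hzero := congrArg Complex.re (eigenDefect_eq_zero hμ hA hW hu hu1 hρ hρc)
  rw [eigenDefect, Complex.add_re, Complex.zero_re] at hzero
  have r1 : (∫ x, sesq (A x) (Du x) (productDifferential u Du (fun x => ‖v x‖ ^ 2) x) ∂μ).re
      = ∫ x, (sesq (A x) (Du x) (productDifferential u Du (fun x => ‖v x‖ ^ 2) x)).re ∂μ :=
    (Complex.reCLM.integral_comp_comm i1).symm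
  have r2 : (∫ x, ((W x - lam : ℝ) : ℂ) * u x *
      (starRingEnd ℂ) (((‖v x‖ ^ 2 : ℝ) : ℂ) * u x) ∂μ).re
      = ∫ x, (((W x - lam : ℝ) : ℂ) * u x *
        (starRingEnd ℂ) (((‖v x‖ ^ 2 : ℝ) : ℂ) * u x)).re ∂μ :=
    (Complex.reCLM.integral_comp_comm i2).symm
  rw [r1, r2] at hzero
  have b1 : (1 - s⁻¹) * (∫ x, ‖v x‖ ^ 2 * (sesq (A x) (Du x) (Du x)).re ∂μ)
      ≤ (∫ x, (sesq (A x) (Du x) (productDifferential u Du (fun x => ‖v x‖ ^ 2) x)).re ∂μ)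
        + s * ∫ x, (sesq (A x) (differential d v x) (differential d v x)).re ∂μ := by
    rw [← integral_const_mul, ← integral_const_mul, ← integral_add i1r (i3.const_mul s)]
    refine integral_mono_ae (hE.const_mul _) (i1r.add (i3.const_mul s)) ?_
    filter_upwards [hu1] with x hx
    have := energy_pointwise_le hA (Du := Du) (hv.1.mdifferentiable (by norm_num) x) hx
      (inv_pos.2 hs0)
    rwa [inv_inv] at this
  have b2 : -(M * ∫ x, ‖v x‖ ^ 2 ∂μ) ≤ ∫ x, (((W x - lam : ℝ) : ℂ) * u x *
        (starRingEnd ℂ) (((‖v x‖ ^ 2 : ℝ) : ℂ) * u x)).re ∂μ := by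
    rw [← integral_const_mul, ← integral_neg]
    refine integral_mono_ae (i4.const_mul M).neg i2.re ?_
    filter_upwards [hu1, hM] with x h1 h2
    refine neg_le_of_abs_le ((Complex.abs_re_le_norm _).trans ?_)
    rw [norm_mul, norm_mul, RCLike.norm_conj, norm_mul, Complex.norm_real, Complex.norm_real,
      Real.norm_eq_abs, Real.norm_of_nonneg (sq_nonneg _)]
    calc |W x - lam| * ‖u x‖ * (‖v x‖ ^ 2 * ‖u x‖)
        ≤ M * 1 * (‖v x‖ ^ 2 * 1) := by gcongr
      _ = _ := by ring
  have b3 := integral_add_integral_le_testNorm_sq hμ hA hW hv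
  have hV : 0 ≤ ∫ x, ‖v x‖ ^ 2 ∂μ := integral_nonneg fun x => sq_nonneg _
  have hQ : 0 ≤ ∫ x, (sesq (A x) (differential d v x) (differential d v x)).re ∂μ :=
    integral_nonneg fun x => sesq_self_nonneg (hA.nonneg x) _
  set E := ∫ x, ‖v x‖ ^ 2 * (sesq (A x) (Du x) (Du x)).re ∂μ
  set V := ∫ x, ‖v x‖ ^ 2 ∂μ
  set Q := ∫ x, (sesq (A x) (differential d v x) (differential d v x)).re ∂μ
  set N := testNorm A μ W v
  have c1 : (1 - s⁻¹) * E ≤ M * V + s * Q := by linarith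
  have c2 : M * V + s * Q ≤ (M + s) * N ^ 2 := by
    have g1 : M * V + s * Q ≤ (M + s) * V + (M + s) * Q :=
      add_le_add (mul_le_mul_of_nonneg_right (by linarith) hV)
        (mul_le_mul_of_nonneg_right (by linarith) hQ)
    have g2 : (M + s) * (Q + V) ≤ (M + s) * N ^ 2 :=
      mul_le_mul_of_nonneg_left b3 (by linarith)
    linarith
  -- After multiplication by `s`, the identity `M = s² - 2 s` gives `s (M + s) = (s - 1) s²`, and
  -- the factor `s - 1 > 0` cancels.
  have c3 : (s - 1) * E ≤ (s - 1) * (s ^ 2 * N ^ 2) := by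
    have := mul_le_mul_of_nonneg_left (c1.trans c2) hs0.le
    have e1 : s * ((1 - s⁻¹) * E) = (s - 1) * E := by field_simp
    have e2 : s * ((M + s) * N ^ 2) = (s - 1) * (s ^ 2 * N ^ 2) := by
      have : M = s ^ 2 - 2 * s := by linarith
      rw [this]; ring
    rwa [e1, e2] at this
  exact le_of_mul_le_mul_left c3 (by linarith)

end Energy

/-! ### Passage from test functions to the form domain. -/

section FormDomain

variable {d : ℕ} {Ω : Type*} [TopologicalSpace Ω] [ChartedSpace (EuclideanSpace ℝ (Fin d)) Ω]
  [MeasurableSpace Ω] {μ : Measure Ω}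
  {A : CoefficientField d Ω} {W : Ω → ℝ} {v : Ω → ℂ} {s : ℕ → Ω → ℂ}

theorem testNorm_nonneg (v : Ω → ℂ) : 0 ≤ testNorm A μ W v := Real.sqrt_nonneg _

theorem IsFormApproximation.subseq (hs : IsFormApproximation A μ W v s) {φ : ℕ → ℕ}
    (hφ : StrictMono φ) : IsFormApproximation A μ W v (s ∘ φ) where
  mem n := hs.mem _
  cauchy ε hε := by
    obtain ⟨N, hN⟩ := hs.cauchy ε hε
    exact ⟨N, fun m hm n hn => hN _ (hm.trans (hφ.id_le m)) _ (hn.trans (hφ.id_le n))⟩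
  tendsto := hs.tendsto.comp hφ.tendsto_atTop

variable [BorelSpace Ω] [IsManifold (𝓡 d) ∞ Ω]

/-- Along a subsequence of an approximating sequence, the form norms converge. -/
theorem IsFormApproximation.exists_tendsto_testNorm (hμ : HasPositiveDensity d μ)
    (hA : IsLocallyElliptic A) (hW : MemLp W ⊤ μ) (hs : IsFormApproximation A μ W v s) :
    ∃ N : ℝ, ∃ φ : ℕ → ℕ, StrictMono φ ∧
      Tendsto (fun n => testNorm A μ W (s (φ n))) atTop (𝓝 N) := by
  obtain ⟨n₀, hn₀⟩ := hs.cauchy 1 one_pos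
  -- From the index `n₀` on, the squared norms are at most `2 · 1² + 2 ‖s n₀‖_q²`; compactness of
  -- the interval then yields a convergent subsequence.
  set B := 2 + 2 * testNorm A μ W (s n₀) ^ 2
  have hB : ∀ n, testNorm A μ W (s (n + n₀)) ∈ Icc 0 √B := by
    intro n
    refine ⟨testNorm_nonneg _, Real.le_sqrt_of_sq_le ?_⟩
    have h1 := testNorm_sq_le hμ hA hW (hs.mem (n + n₀)) (hs.mem n₀)
    have h2 := hn₀ (n + n₀) (Nat.le_add_left _ _) n₀ le_rfl
    have h3 : testNorm A μ W (s (n + n₀) - s n₀) ^ 2 ≤ 1 :=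
      pow_le_one₀ (testNorm_nonneg _) h2.le
    linarith
  obtain ⟨N, -, φ, hφ, hN⟩ := isCompact_Icc.tendsto_subseq hB
  exact ⟨N, fun n => φ n + n₀, fun _ _ h => Nat.add_lt_add_right (hφ h) _, hN⟩

/-- An element of the form domain has approximating sequences with norms close to its form norm. -/
theorem exists_isFormApproximation_of_formNorm_lt (hμ : HasPositiveDensity d μ)
    (hA : IsLocallyElliptic A) (hW : MemLp W ⊤ μ) (hv : v ∈ formDomain A μ W) {r : ℝ}
    (hr : formNorm A μ W v < r) :
    ∃ s, IsFormApproximation A μ W v s ∧ ∃ N, N < r ∧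
      Tendsto (fun n => testNorm A μ W (s n)) atTop (𝓝 N) := by
  obtain ⟨-, s, hs⟩ := hv
  obtain ⟨N, φ, hφ, hN⟩ := hs.exists_tendsto_testNorm hμ hA hW
  -- The infimum of the empty set is 0 by convention, so without this a bound on `formNorm` would
  -- produce no sequence.
  have hne : {N : ℝ | ∃ s, IsFormApproximation A μ W v s ∧
      Tendsto (fun n => testNorm A μ W (s n)) atTop (𝓝 N)}.Nonempty :=
    ⟨N, s ∘ φ, hs.subseq hφ, hN⟩
  obtain ⟨N', ⟨s', h1, h2⟩, h3⟩ := exists_lt_of_csInf_lt hne hr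
  exact ⟨s', h1, N', h3, h2⟩

variable [T2Space Ω] [SecondCountableTopology Ω] {lam : ℝ} {u : Ω → ℂ} {Du : CovectorField d Ω}

omit [T2Space Ω] in
theorem aemeasurable_energy (hμ : HasPositiveDensity d μ) (hA : IsLocallyElliptic A)
    (hu : HasLocalWeakDifferential u Du) :
    AEMeasurable (fun x => (sesq (A x) (Du x) (Du x)).re) μ :=
  Complex.measurable_re.comp_aemeasurable (hA.locallyIntegrable_sesq hμ hu.memLp_differential
    hu.memLp_differential).aestronglyMeasurable.aemeasurable

/-- The energy inequality along an approximating sequence, by Fatou's lemma. -/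
theorem IsFormApproximation.lintegral_energy_le (hμ : HasPositiveDensity d μ)
    (hA : IsLocallyElliptic A) (hW : MemLp W ⊤ μ)
    (hu : IsGeneralizedEigenfunction A μ W lam u Du) (hu1 : ∀ᵐ x ∂μ, ‖u x‖ ≤ 1)
    (hv : AEStronglyMeasurable v μ) (hs : IsFormApproximation A μ W v s) {N : ℝ}
    (hN : Tendsto (fun n => testNorm A μ W (s n)) atTop (𝓝 N)) :
    ∫⁻ x, ENNReal.ofReal (‖v x‖ ^ 2 * (sesq (A x) (Du x) (Du x)).re) ∂μ
      ≤ ENNReal.ofReal ((1 + √(1 + |lam| + supNorm μ W)) ^ 2 * N ^ 2) := by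
  have hm := aemeasurable_energy hμ hA hu.weak
  have hsm : ∀ n, AEStronglyMeasurable (s n) μ := fun n =>
    (hs.mem n).1.continuous.aestronglyMeasurable
  -- `L²` convergence gives convergence in measure, hence a.e. convergence of a subsequence, as
  -- Fatou's lemma requires.
  have hconv : TendstoInMeasure μ s atTop v := by
    refine tendstoInMeasure_of_tendsto_eLpNorm (p := 2) (by norm_num) hsm hv ?_
    simpa only [eLpNorm_sub_comm] using hs.tendsto
  obtain ⟨φ, hφ, hae⟩ := hconv.exists_seq_tendsto_ae
  calc ∫⁻ x, ENNReal.ofReal (‖v x‖ ^ 2 * (sesq (A x) (Du x) (Du x)).re) ∂μ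
      = ∫⁻ x, liminf (fun n => ENNReal.ofReal
          (‖s (φ n) x‖ ^ 2 * (sesq (A x) (Du x) (Du x)).re)) atTop ∂μ := by
        refine lintegral_congr_ae ?_
        filter_upwards [hae] with x hx
        exact ((ENNReal.continuous_ofReal.tendsto _).comp
          ((hx.norm.pow 2).mul_const _)).liminf_eq.symm
    _ ≤ liminf (fun n => ∫⁻ x, ENNReal.ofReal
          (‖s (φ n) x‖ ^ 2 * (sesq (A x) (Du x) (Du x)).re) ∂μ) atTop :=
        lintegral_liminf_le' fun n =>
          (((hsm (φ n)).norm.aemeasurable.pow_const 2).mul hm).ennreal_ofReal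
    _ ≤ liminf (fun n => ENNReal.ofReal ((1 + √(1 + |lam| + supNorm μ W)) ^ 2 *
          testNorm A μ W (s (φ n)) ^ 2)) atTop := by
        refine liminf_le_liminf (Eventually.of_forall fun n => ?_)
        obtain ⟨h1, h2⟩ := energy_le hμ hA hW hu hu1 (hs.mem (φ n))
        rw [← ofReal_integral_eq_lintegral_ofReal h1 (ae_of_all _ fun x =>
          mul_nonneg (sq_nonneg _) (sesq_self_nonneg (hA.nonneg x) _))]
        exact ENNReal.ofReal_le_ofReal h2
    _ = _ := ((ENNReal.continuous_ofReal.tendsto _).comp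
          (((hN.comp hφ.tendsto_atTop).pow 2).const_mul _)).liminf_eq

end FormDomain

end Shnol

/-! ### The bound for form norm at most one. -/

theorem proposition4p1 {d : ℕ} {Ω : Type*} [TopologicalSpace Ω]
    [ChartedSpace (EuclideanSpace ℝ (Fin d)) Ω] [IsManifold (𝓡 d) ∞ Ω]
    [T2Space Ω] [SecondCountableTopology Ω] [ConnectedSpace Ω] [NoncompactSpace Ω]
    [MeasurableSpace Ω] [BorelSpace Ω]
    (μ : Measure Ω) (hμ : Shnol.HasPositiveDensity d μ)
    (A : Shnol.CoefficientField d Ω) (hA : Shnol.IsLocallyElliptic A)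
    (W : Ω → ℝ) (hW : MemLp W ⊤ μ)
    (lam : ℝ) (u : Ω → ℂ) (Du : Shnol.CovectorField d Ω)
    (hu : Shnol.IsGeneralizedEigenfunction A μ W lam u Du)
    (hu_le : ∀ᵐ x ∂μ, ‖u x‖ ≤ 1)
    (v : Ω → ℂ) (hv : v ∈ Shnol.formDomain A μ W) (hv_le : Shnol.formNorm A μ W v ≤ 1) :
    Integrable (fun x => ‖v x‖ ^ 2 * (Shnol.sesq (A x) (Du x) (Du x)).re) μ ∧
      ∫ x, ‖v x‖ ^ 2 * (Shnol.sesq (A x) (Du x) (Du x)).re ∂μ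
        ≤ (1 + Real.sqrt (1 + |lam| + Shnol.supNorm μ W)) ^ 2 := by
  have hm := Shnol.aemeasurable_energy hμ hA hu.weak
  have hnn : ∀ x, 0 ≤ ‖v x‖ ^ 2 * (Shnol.sesq (A x) (Du x) (Du x)).re := fun x =>
    mul_nonneg (sq_nonneg _) (Shnol.sesq_self_nonneg (hA.nonneg x) _)
  set c := (1 + Real.sqrt (1 + |lam| + Shnol.supNorm μ W)) ^ 2
  have hc : 0 ≤ c := sq_nonneg _
  -- The infimum defining `formNorm` need not be attained a priori, so the bound is proved for every
  -- `r > 1` and then `r` tends to 1.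
  have hbound : ∀ r : ℝ, 1 < r →
      ∫⁻ x, ENNReal.ofReal (‖v x‖ ^ 2 * (Shnol.sesq (A x) (Du x) (Du x)).re) ∂μ
        ≤ ENNReal.ofReal (c * r ^ 2) := by
    intro r hr
    obtain ⟨s, hs, N, hNr, hN⟩ :=
      Shnol.exists_isFormApproximation_of_formNorm_lt hμ hA hW hv (hv_le.trans_lt hr)
    have hN0 : 0 ≤ N := ge_of_tendsto' hN fun n => Shnol.testNorm_nonneg _
    refine (hs.lintegral_energy_le hμ hA hW hu hu_le hv.1.1 hN).trans ?_
    exact ENNReal.ofReal_le_ofReal (mul_le_mul_of_nonneg_left (by gcongr) hc)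
  have hle : ∫⁻ x, ENNReal.ofReal (‖v x‖ ^ 2 * (Shnol.sesq (A x) (Du x) (Du x)).re) ∂μ
      ≤ ENNReal.ofReal c := by
    have hlim : Tendsto (fun r : ℝ => ENNReal.ofReal (c * r ^ 2)) (𝓝[>] 1)
        (𝓝 (ENNReal.ofReal c)) := by
      have h : Continuous fun r : ℝ => ENNReal.ofReal (c * r ^ 2) :=
        ENNReal.continuous_ofReal.comp (by fun_prop)
      simpa using (h.tendsto 1).mono_left nhdsWithin_le_nhds
    exact ge_of_tendsto hlim (by filter_upwards [self_mem_nhdsWithin] with r hr using hbound r hr)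
  have hmeas : AEStronglyMeasurable
      (fun x => ‖v x‖ ^ 2 * (Shnol.sesq (A x) (Du x) (Du x)).re) μ :=
    ((hv.1.1.norm.aemeasurable.pow_const 2).mul hm).aestronglyMeasurable
  refine ⟨⟨hmeas, ?_⟩, ?_⟩
  · rw [hasFiniteIntegral_iff_ofReal (ae_of_all _ hnn)]
    exact hle.trans_lt ENNReal.ofReal_lt_top
  · rw [integral_eq_lintegral_of_nonneg_ae (ae_of_all _ hnn) hmeas]
    exact ENNReal.toReal_le_of_le_ofReal hc hle
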